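/- Let $e,f,h$ be the standard basis of $\mathfrak{sl}_2(\mathbb C)$, and let $\widehat{\mathfrak{sl}_2}=\mathfrak{sl}_2[T,T^{-1}]\oplus\mathbb C c$ be the affine Lie algebra, with $c$ central and $[xT^i,yT^j]=[x,y]T^{i+j}+i\,\mathrm{tr}(xy)\,\delta_{i+j,0}\,c$. Write $\frac{x}{T^n}=xT^{-n}$ and put $e_1=e$, $e_2=fT$, $f_1=f$, $f_2=eT^{-1}$, $h_1=h$, $h_2=c-h$. For $m,k\in\mathbb C$ let $V=V(m,k-m)$ be the Verma module generated by a vector $v$ subject to $e_1v=e_2v=0$, $h_1v=mv$, $h_2v=(k-m)v$. It is graded by $\mathbb Z_{\ge0}^2$: $V_{(p_1,p_2)}$ is spanned by the vectors $f_{i_1}\cdots f_{i_p}v$ in which $1$ occurs $p_1$ times and $2$ occurs $p_2$ times among the indices. The contragredient Verma module is $V^*=\bigoplus_\gamma V_\gamma^*$ with the action determined by $\langle f_i\varphi,x\rangle=\langle\varphi,e_ix\rangle$ and $\langle e_i\varphi,x\rangle=\langle\varphi,f_ix\rangle$, $i=1,2$. In $V_{(p_1,p_2)}$ with $p_1\ge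 p_2$ consider the vectors $$\frac{f}{T^{i_1}}\cdots\frac{f}{T^{i_r}}\,\frac{h}{T^{j_1}}\cdots\frac{h}{T^{j_s}}\,\frac{e}{T^{l_1}}\cdots\frac{e}{T^{l_t}}\,v,$$ and in $V_{(p_1,p_2)}$ with $p_1<p_2$ the vectors $$\frac{e}{T^{l_1}}\cdots\frac{e}{T^{l_t}}\,\frac{h}{T^{j_1}}\cdots\frac{h}{T^{j_s}}\,\frac{f}{T^{i_1}}\cdots\frac{f}{T^{i_r}}\,v,$$ where in both cases $i_1\ge\dots\ge i_r\ge0$, $j_1\ge\dots\ge j_s\ge1$, $l_1\ge\dots\ge l_t\ge1$, $\sum i+\sum j+\sum l=p_2$ and $p_2+r-t=p_1$. For such a vector $w$ of degree $\gamma$, let $(w)^*\in V^*$ be the covector that equals $1$ on $w$, $0$ on the other listed vectors of degree $\gamma$, and $0$ on $V_{\gamma'}$ for all $\gamma'\ne\gamma$. **Theorem.** For all $m,k\in\mathbb C$ and all integers $a>0$, each covector $(w)^*$ exists and is unique, and the following identities hold in $V(m,k-m)^*$: $$\frac{f}{T^{a-1}}(v)^*=\bigl(m+(a-1)(k+2)\bigr)\Bigl(\frac{f}{T^{a-1}}v\Bigr)^*+\sum_{\ell=1}^{a-1}\Bigl[\frac{h}{T^\ell}\Bigl(\frac{f}{T^{a-1-\ell}}v\Bigr)^*+2\,\frac{e}{T^\ell}\sum_{\substack{i+j=a-1-\ell\\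 i\ge j\ge0}}\Bigl(\frac{f}{T^i}\frac{f}{T^j}v\Bigr)^*\Bigr],\tag{A}$$ $$\frac{e}{T^{a}}(v)^*=\bigl(a(k+2)-m-2\bigr)\Bigl(\frac{e}{T^{a}}v\Bigr)^*+\sum_{\ell=0}^{a-2}\Bigl[-\frac{h}{T^{\ell+1}}\Bigl(\frac{e}{T^{a-\ell-1}}v\Bigr)^*+2\,\frac{f}{T^\ell}\sum_{\substack{i+j=a-\ell\\ i\ge j\ge1}}\Bigl(\frac{e}{T^i}\frac{e}{T^j}v\Bigr)^*\Bigr].\tag{B}$$ -/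

import Mathlib

open scoped TensorProduct

noncomputable section

namespace AffineSl2

/-! ### The Lie algebra `sl₂` and its standard generators -/

/-- The Lie algebra of traceless complex `2 × 2` matrices. -/
abbrev Sl2 := LieAlgebra.SpecialLinear.sl (Fin 2) ℂ

/-- The standard generator `e`. -/
def e : Sl2 := ⟨!![0, 1; 0, 0], by
  simp [LieAlgebra.SpecialLinear.sl, Matrix.trace_fin_two]⟩

/-- The standard generator `f`. -/
def f : Sl2 := ⟨!![0, 0; 1, 0], by
  simp [LieAlgebra.SpecialLinear.sl, Matrix.trace_fin_two]⟩

/-- The standard generator `h`. -/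
def h : Sl2 := ⟨!![1, 0; 0, -1], by
  simp [LieAlgebra.SpecialLinear.sl, Matrix.trace_fin_two]⟩

/-- The invariant form `⟨a, b⟩ = tr (a b)` on `sl₂`. -/
def traceForm : LinearMap.BilinForm ℂ Sl2 :=
  LinearMap.mk₂ ℂ (fun a b => Matrix.trace (a.1 * b.1))
    (fun a b c => by simp [add_mul]) (fun r a b => by simp)
    (fun a b c => by simp [mul_add]) (fun r a b => by simp)

theorem traceForm_apply (a b : Sl2) : traceForm a b = Matrix.trace (a.1 * b.1) := rfl

theorem traceForm_comm (a b : Sl2) : traceForm a b = traceForm b a := by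
  simp only [traceForm_apply]; exact Matrix.trace_mul_comm _ _

theorem traceForm_isSymm : traceForm.IsSymm := ⟨traceForm_comm⟩

theorem traceForm_lieInvariant : traceForm.lieInvariant Sl2 := by
  intro x y z
  simp only [traceForm_apply, LieAlgebra.SpecialLinear.sl_bracket]
  simp only [sub_mul, mul_sub, Matrix.trace_sub]
  rw [Matrix.mul_assoc y.1 x.1 z.1, Matrix.trace_mul_comm (x.1 * y.1) z.1, ← Matrix.mul_assoc,
    ← Matrix.mul_assoc, Matrix.trace_mul_comm (z.1 * x.1) y.1, ← Matrix.mul_assoc]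
  rw [Matrix.mul_assoc y.1 x.1 z.1]
  ring

theorem neg_traceForm_isSymm : (-traceForm).IsSymm :=
  ⟨fun a b => by simp [traceForm_comm a b]⟩

theorem neg_traceForm_lieInvariant : (-traceForm).lieInvariant Sl2 := by
  intro x y z
  simp [traceForm_lieInvariant x y z]

/-! ### The affine Lie algebra -/

/-- The loop algebra `sl₂[T, T⁻¹]`. -/
abbrev LoopSl2 := LieAlgebra.loopAlgebra ℂ ℤ Sl2

/-- The 2-cocycle `(a Tⁱ, b Tʲ) ↦ i ⟨a, b⟩ δ_{i+j,0}` on the loop algebra. Mathlib's cocycle attached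
to a form `Φ` is `(a Tⁱ, b Tʲ) ↦ j Φ(a, b) δ_{i+j,0}`, hence the sign of the form; see
`lie_loop_loop` below. -/
def cocycle : LieModule.Cohomology.twoCocycle ℂ LoopSl2 (TrivialLieModule ℂ LoopSl2 ℂ) :=
  LieAlgebra.LoopAlgebra.twoCocycleOfBilinear ℂ ℤ Sl2 (-traceForm)
    neg_traceForm_lieInvariant neg_traceForm_isSymm

/-- The affine Lie algebra `sl₂[T, T⁻¹] ⊕ ℂ c`. -/
abbrev AffSl2 := LieAlgebra.ofTwoCocycle cocycle

/-- The element `a Tⁿ` of the affine Lie algebra, as a linear function of `a`. -/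
def loop (n : ℤ) : Sl2 →ₗ[ℂ] AffSl2 where
  toFun a := LieAlgebra.ofProd cocycle (AddMonoidAlgebra.single n 1 ⊗ₜ[ℂ] a, 0)
  map_add' a b := by simp [← LieAlgebra.of_add, TensorProduct.tmul_add]
  map_smul' r a := by simp [← LieAlgebra.of_smul]

/-- The central element `c`. -/
def c : AffSl2 :=
  LieAlgebra.ofProd cocycle (0, (TrivialLieModule.equiv ℂ LoopSl2 ℂ).symm 1)

theorem lie_loop_loop (a b : Sl2) (i j : ℤ) :
    ⁅loop i a, loop j b⁆ =
      loop (i + j) ⁅a, b⁆ + (if i + j = 0 then (i : ℂ) * traceForm a b else 0) • c := by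
  have hr : LieAlgebra.LoopAlgebra.residuePairing ℂ ℤ Sl2 (-traceForm)
      (AddMonoidAlgebra.single i 1 ⊗ₜ[ℂ] a) (AddMonoidAlgebra.single j 1 ⊗ₜ[ℂ] b) =
      if i + j = 0 then (i : ℂ) * traceForm a b else 0 := by
    rw [LieAlgebra.LoopAlgebra.residuePairing_apply_apply]
    simp only [LieAlgebra.LoopAlgebra.toFinsupp_single_tmul]
    rw [Finsupp.sum_single_index (by simp)]
    by_cases hij : i + j = 0
    · obtain rfl : i = -j := by omega
      rw [neg_add_cancel, if_pos rfl, Finsupp.single_eq_same]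
      simp
    · rw [if_neg hij, Finsupp.single_eq_of_ne (by omega)]
      simp
  rw [LieAlgebra.bracket_ofTwoCocycle, ← hr]
  simp only [loop, c, LinearMap.coe_mk, AddHom.coe_mk, Equiv.symm_apply_apply, ← LieAlgebra.of_smul,
    ← LieAlgebra.of_add]
  congr 1
  ext
  · simp [LieAlgebra.ExtendScalars.bracket_tmul, AddMonoidAlgebra.single_mul_single,
      -LaurentPolynomial.single_eq_C_mul_T]
  · simp only [cocycle, LieAlgebra.LoopAlgebra.twoCocycleOfBilinear_coe,
      LieAlgebra.LoopAlgebra.twoCochainOfBilinear_apply_apply, lie_zero, sub_zero, add_zero,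
      LieModule.Cohomology.twoCochain_val_apply, Prod.snd_add, zero_add, Prod.smul_snd]
    rw [← map_smul, smul_eq_mul, mul_one]

theorem lie_c (x : AffSl2) : ⁅x, c⁆ = 0 := by
  rw [LieAlgebra.bracket_ofTwoCocycle, ← LieAlgebra.of_zero]
  simp only [c, Equiv.symm_apply_apply, map_zero, lie_zero, sub_zero, zero_add,
    LieModule.IsTrivial.trivial]
  rfl

theorem affSl2_induction {P : AffSl2 → Prop} (hadd : ∀ x y, P x → P y → P (x + y))
    (hsmul : ∀ (r : ℂ) x, P x → P (r • x)) (hc : P c) (hloop : ∀ n a, P (loop n a)) (x) : P x := by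
  have h0 : P 0 := by simpa using hsmul 0 c hc
  obtain ⟨⟨y, z⟩, rfl⟩ := (LieAlgebra.ofProd cocycle).surjective x
  have hz : P (LieAlgebra.ofProd cocycle (0, z)) := by
    have := hsmul (TrivialLieModule.equiv ℂ LoopSl2 ℂ z) c hc
    rw [c, ← LieAlgebra.of_smul] at this
    convert this using 2
    ext
    · simp
    · simp [← map_smul]
  have hy : P (LieAlgebra.ofProd cocycle (y, 0)) := by
    induction y using TensorProduct.induction_on with
    | zero => exact h0
    | add y₁ y₂ h₁ h₂ =>
      have := hadd _ _ h₁ h₂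
      rw [← LieAlgebra.of_add] at this
      simpa using this
    | tmul p a =>
      induction p using AddMonoidAlgebra.induction_linear with
      | zero => rw [TensorProduct.zero_tmul]; exact h0
      | add p q hp hq =>
        have := hadd _ _ hp hq
        rw [← LieAlgebra.of_add] at this
        simpa [TensorProduct.add_tmul] using this
      | single n r =>
        have := hloop n (r • a)
        simp only [loop, LinearMap.coe_mk, AddHom.coe_mk] at this
        rw [← TensorProduct.smul_tmul, AddMonoidAlgebra.smul_single] at this
        simpa using this
  have := hadd _ _ hy hz
  rw [← LieAlgebra.of_add] at this
  simpa using this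

/-- Transposition on `sl₂`. -/
def transpose : Sl2 →ₗ[ℂ] Sl2 where
  toFun a := ⟨a.1.transpose, by
    have := a.2
    simp only [LieAlgebra.SpecialLinear.sl] at this ⊢
    simpa using this⟩
  map_add' a b := by ext; simp
  map_smul' r a := by ext; simp

/-- The Chevalley anti-involution of the affine Lie algebra: `a Tⁿ ↦ aᵗ T⁻ⁿ`, `c ↦ c`. -/
def chev : AffSl2 →ₗ[ℂ] AffSl2 where
  toFun x := LieAlgebra.ofProd cocycle
    (TensorProduct.map (AddMonoidAlgebra.mapDomainLinearMap ℂ ℂ (Neg.neg : ℤ → ℤ)) transpose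
      ((LieAlgebra.ofProd cocycle).symm x).1, ((LieAlgebra.ofProd cocycle).symm x).2)
  map_add' x y := by simp [← LieAlgebra.of_add]
  map_smul' r x := by simp [← LieAlgebra.of_smul]

theorem chev_loop (n : ℤ) (a : Sl2) : chev (loop n a) = loop (-n) (transpose a) := by
  change LieAlgebra.ofProd cocycle (TensorProduct.map (AddMonoidAlgebra.mapDomainLinearMap ℂ ℂ _)
    transpose (AddMonoidAlgebra.single n 1 ⊗ₜ[ℂ] a), 0) = _
  rw [TensorProduct.map_tmul, AddMonoidAlgebra.mapDomainLinearMap_single]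
  rfl

theorem chev_c : chev c = c := by
  change LieAlgebra.ofProd cocycle (TensorProduct.map _ _ 0, _) = _
  rw [map_zero]
  rfl

theorem transpose_lie (a b : Sl2) : transpose ⁅a, b⁆ = ⁅transpose b, transpose a⁆ := by
  apply Subtype.ext
  simp only [transpose, LinearMap.coe_mk, AddHom.coe_mk, LieAlgebra.SpecialLinear.sl_bracket,
    Matrix.transpose_mul, Matrix.transpose_sub]

theorem traceForm_transpose (a b : Sl2) :
    traceForm (transpose a) (transpose b) = traceForm a b := by
  simp only [traceForm_apply, transpose, LinearMap.coe_mk, AddHom.coe_mk]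
  rw [← Matrix.transpose_mul, Matrix.trace_transpose, Matrix.trace_mul_comm]

theorem chev_lie (x y : AffSl2) : chev ⁅x, y⁆ = ⁅chev y, chev x⁆ := by
  induction x using affSl2_induction with
  | hadd x₁ x₂ h₁ h₂ => simp [h₁, h₂]
  | hsmul r x h₁ => simp [h₁]
  | hc => rw [← lie_skew, chev_c, lie_c, lie_c]; simp
  | hloop i a =>
    induction y using affSl2_induction with
    | hadd x₁ x₂ h₁ h₂ => simp [h₁, h₂]
    | hsmul r x h₁ => simp [h₁]
    | hc => rw [chev_c, ← lie_skew c, lie_c, lie_c]; simp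
    | hloop j b =>
      rw [lie_loop_loop, chev_loop, chev_loop, lie_loop_loop, map_add, map_smul, chev_c, chev_loop,
        transpose_lie, traceForm_transpose, traceForm_comm b a, neg_add_rev]
      congr 2
      by_cases hij : i + j = 0
      · obtain rfl : i = -j := by omega
        simp
      · rw [if_neg hij, if_neg (by omega)]

theorem lie_e_f : ⁅e, f⁆ = h := by
  apply Subtype.ext
  rw [LieAlgebra.SpecialLinear.sl_bracket]
  ext i j
  fin_cases i <;> fin_cases j <;> simp [e, f, h]

theorem lie_h_e : ⁅h, e⁆ = (2 : ℂ) • e := by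
  apply Subtype.ext
  rw [LieAlgebra.SpecialLinear.sl_bracket]
  ext i j
  fin_cases i <;> fin_cases j <;> simp [e, h]
  norm_num

theorem lie_h_f : ⁅h, f⁆ = (-2 : ℂ) • f := by
  apply Subtype.ext
  rw [LieAlgebra.SpecialLinear.sl_bracket]
  ext i j
  fin_cases i <;> fin_cases j <;> simp [f, h]
  norm_num

theorem transpose_e : transpose e = f := by
  apply Subtype.ext
  ext i j
  fin_cases i <;> fin_cases j <;> simp [transpose, e, f]

theorem transpose_f : transpose f = e := by
  apply Subtype.ext
  ext i j
  fin_cases i <;> fin_cases j <;> simp [transpose, e, f]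

theorem sl2_eq (a : Sl2) : a = a.1 0 1 • e + a.1 1 0 • f + a.1 0 0 • h := by
  have ha : a.1 0 0 + a.1 1 1 = 0 := by
    have := a.2
    rw [← Matrix.trace_fin_two]
    exact this
  apply Subtype.ext
  ext i j
  fin_cases i <;> fin_cases j <;> simp [e, f, h]
  linear_combination ha

/-- The Chevalley generators `e₁ = e`, `e₂ = f T`, indexed by `Fin 2`. -/
def chevE : Fin 2 → AffSl2 := ![loop 0 e, loop 1 f]

/-- The Chevalley generators `f₁ = f`, `f₂ = e T⁻¹`. -/
def chevF : Fin 2 → AffSl2 := ![loop 0 f, loop (-1) e]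

/-- The Chevalley generators `h₁ = h`, `h₂ = c - h`. -/
def chevH : Fin 2 → AffSl2 := ![loop 0 h, c - loop 0 h]

theorem chev_chevE (i : Fin 2) : chev (chevE i) = chevF i := by
  fin_cases i <;> simp [chevE, chevF, chev_loop, transpose_e, transpose_f]

theorem chev_chevF (i : Fin 2) : chev (chevF i) = chevE i := by
  rw [← chev_chevE]
  fin_cases i <;> simp [chevE, chev_loop, transpose_e, transpose_f]

theorem lie_chevE_chevF (i j : Fin 2) : ⁅chevE i, chevF j⁆ = if i = j then chevH i else 0 := by
  have hfe : ⁅f, e⁆ = -h := by rw [← lie_skew, lie_e_f]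
  have hc : traceForm f e = 1 := by simp [traceForm_apply, e, f, Matrix.trace_fin_two]
  fin_cases i <;> fin_cases j <;>
    simp [chevE, chevF, chevH, lie_loop_loop, lie_e_f, hfe, hc]
  abel

/-- The Cartan matrix of the affine Lie algebra. -/
def cartan : Fin 2 → Fin 2 → ℂ := ![![2, -2], ![-2, 2]]

theorem lie_chevH_chevF (i j : Fin 2) : ⁅chevH i, chevF j⁆ = -cartan i j • chevF j := by
  have h2 (x : AffSl2) : ⁅c, x⁆ = 0 := by rw [← lie_skew, lie_c, neg_zero]
  fin_cases i <;> fin_cases j <;>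
    simp [chevF, chevH, lie_loop_loop, lie_h_e, lie_h_f, cartan, h2]

/-! ### Verma modules -/

/-- The left ideal of the enveloping algebra generated by `e₁`, `e₂`, `h₁ - m₁`, `h₂ - m₂`. -/
def vermaIdeal (m₁ m₂ : ℂ) : Ideal (UniversalEnvelopingAlgebra ℂ AffSl2) :=
  Ideal.span {UniversalEnvelopingAlgebra.ι ℂ (chevE 0), UniversalEnvelopingAlgebra.ι ℂ (chevE 1),
    UniversalEnvelopingAlgebra.ι ℂ (chevH 0) - algebraMap ℂ _ m₁,
    UniversalEnvelopingAlgebra.ι ℂ (chevH 1) - algebraMap ℂ _ m₂}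

/-- The Verma module `V(m₁, m₂)`: generated by a vector `v` subject to the relations
`e₁ v = e₂ v = 0`, `h₁ v = m₁ v`, `h₂ v = m₂ v`. -/
def Verma (m₁ m₂ : ℂ) : Type := UniversalEnvelopingAlgebra ℂ AffSl2 ⧸ vermaIdeal m₁ m₂

section Verma

variable (m₁ m₂ : ℂ)

instance : AddCommGroup (Verma m₁ m₂) :=
  inferInstanceAs (AddCommGroup (UniversalEnvelopingAlgebra ℂ AffSl2 ⧸ vermaIdeal m₁ m₂))

instance : Module (UniversalEnvelopingAlgebra ℂ AffSl2) (Verma m₁ m₂) :=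
  inferInstanceAs (Module _ (UniversalEnvelopingAlgebra ℂ AffSl2 ⧸ vermaIdeal m₁ m₂))

instance : Module ℂ (Verma m₁ m₂) :=
  inferInstanceAs (Module ℂ (UniversalEnvelopingAlgebra ℂ AffSl2 ⧸ vermaIdeal m₁ m₂))

instance : IsScalarTower ℂ (UniversalEnvelopingAlgebra ℂ AffSl2) (Verma m₁ m₂) :=
  inferInstanceAs (IsScalarTower ℂ (UniversalEnvelopingAlgebra ℂ AffSl2)
    (UniversalEnvelopingAlgebra ℂ AffSl2 ⧸ vermaIdeal m₁ m₂))

instance : SMulCommClass ℂ (UniversalEnvelopingAlgebra ℂ AffSl2) (Verma m₁ m₂) :=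
  IsScalarTower.to_smulCommClass

/-- The affine Lie algebra acts on the Verma module through its enveloping algebra. -/
instance : LieRingModule AffSl2 (Verma m₁ m₂) where
  bracket x w := UniversalEnvelopingAlgebra.ι ℂ x • w
  add_lie x y w := by simp [add_smul]
  lie_add x w w' := by simp
  leibniz_lie x y w := by
    simp [LieRing.of_associative_ring_bracket, sub_smul, mul_smul]

instance : LieModule ℂ AffSl2 (Verma m₁ m₂) where
  smul_lie r x w := by
    change UniversalEnvelopingAlgebra.ι ℂ (r • x) • w = r • UniversalEnvelopingAlgebra.ι ℂ x • w
    simp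
  lie_smul r x w := smul_comm (UniversalEnvelopingAlgebra.ι ℂ x) r w

/-- The generating vector `v` of the Verma module. -/
def hwv : Verma m₁ m₂ := (vermaIdeal m₁ m₂).mkQ 1

variable {m₁ m₂}

theorem chevE_hwv (i : Fin 2) : ⁅chevE i, hwv m₁ m₂⁆ = 0 := by
  change (vermaIdeal m₁ m₂).mkQ (UniversalEnvelopingAlgebra.ι ℂ (chevE i) • 1) = 0
  rw [smul_eq_mul, mul_one, Submodule.mkQ_apply, Submodule.Quotient.mk_eq_zero]
  apply Ideal.subset_span
  fin_cases i <;> simp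

theorem chevH_hwv (i : Fin 2) : ⁅chevH i, hwv m₁ m₂⁆ = (![m₁, m₂] i) • hwv m₁ m₂ := by
  change (vermaIdeal m₁ m₂).mkQ (UniversalEnvelopingAlgebra.ι ℂ (chevH i) • 1) =
    (vermaIdeal m₁ m₂).mkQ ((![m₁, m₂] i) • 1)
  rw [← sub_eq_zero, ← map_sub, smul_eq_mul, mul_one, Submodule.mkQ_apply,
    Submodule.Quotient.mk_eq_zero, ← Algebra.algebraMap_eq_smul_one]
  apply Ideal.subset_span
  fin_cases i <;> simp

/-- The vector `x₁ x₂ ⋯ xₚ v` of the Verma module. -/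
def act (l : List AffSl2) : Verma m₁ m₂ := l.foldr (fun x w => ⁅x, w⁆) (hwv m₁ m₂)

theorem act_cons (x : AffSl2) (l : List AffSl2) :
    act (x :: l) = ⁅x, (act l : Verma m₁ m₂)⁆ := rfl

variable (m₁ m₂) in
/-- The homogeneous component `V_γ`: the span of the vectors `f_{i₁} ⋯ f_{iₚ} v` whose index
sequence contains `γ.1` times the first index and `γ.2` times the second one. -/
def component (γ : ℕ × ℕ) : Submodule ℂ (Verma m₁ m₂) :=
  Submodule.span ℂ {w | ∃ l : List (Fin 2), l.count 0 = γ.1 ∧ l.count 1 = γ.2 ∧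
    w = act (l.map chevF)}

/-! ### The contragredient Verma module -/

/-- A functional on the Verma module has finite support if it vanishes on all but finitely many
homogeneous components. -/
def FiniteSupport (φ : Module.Dual ℂ (Verma m₁ m₂)) : Prop :=
  {γ : ℕ × ℕ | ∃ w ∈ component m₁ m₂ γ, φ w ≠ 0}.Finite

variable (m₁ m₂) in
/-- The restricted dual `V* = ⨁_γ V_γ*`, realized as the space of functionals on `V = ⨁_γ V_γ` that
vanish on all but finitely many components. -/
def Contragredient : Submodule ℂ (Module.Dual ℂ (Verma m₁ m₂)) where
  carrier := {φ | FiniteSupport φ}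
  zero_mem' := by simp [FiniteSupport]
  add_mem' {φ ψ} hφ hψ := by
    refine (Set.Finite.union hφ hψ).subset ?_
    rintro γ ⟨w, hw, hne⟩
    by_contra hcon
    simp only [Set.mem_union, Set.mem_ofPred_eq, not_or, not_exists, not_and, not_not] at hcon
    exact hne (by simp [hcon.1 w hw, hcon.2 w hw])
  smul_mem' r φ hφ := by
    refine Set.Finite.subset hφ ?_
    rintro γ ⟨w, hw, hne⟩
    exact ⟨w, hw, fun h0 => hne (by simp [h0])⟩

theorem act_mem_component (l : List (Fin 2)) :
    act (l.map chevF) ∈ component m₁ m₂ (l.count 0, l.count 1) :=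
  Submodule.subset_span ⟨l, rfl, rfl, rfl⟩

theorem component_le {γ : ℕ × ℕ} {S : Submodule ℂ (Verma m₁ m₂)} (x : AffSl2)
    (hS : ∀ l : List (Fin 2), l.count 0 = γ.1 → l.count 1 = γ.2 → ⁅x, act (l.map chevF)⁆ ∈ S)
    {w : Verma m₁ m₂} (hw : w ∈ component m₁ m₂ γ) : ⁅x, w⁆ ∈ S := by
  induction hw using Submodule.span_induction with
  | mem w hw =>
    obtain ⟨l, h0, h1, rfl⟩ := hw
    exact hS l h0 h1
  | zero => simp
  | add w w' _ _ hw hw' => rw [lie_add]; exact S.add_mem hw hw'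
  | smul r w _ hw => rw [lie_smul]; exact S.smul_mem r hw

/-- The degree of the generator `fᵢ`. -/
def deg (i : Fin 2) : ℕ × ℕ := (if i = 0 then 1 else 0, if i = 1 then 1 else 0)

theorem count_cons (i : Fin 2) (l : List (Fin 2)) :
    ((i :: l).count 0, (i :: l).count 1) = deg i + (l.count 0, l.count 1) := by
  fin_cases i <;> simp [deg, add_comm]

theorem chevF_component (i : Fin 2) {γ : ℕ × ℕ} {w : Verma m₁ m₂} (hw : w ∈ component m₁ m₂ γ) :
    ⁅chevF i, w⁆ ∈ component m₁ m₂ (deg i + γ) := by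
  refine component_le _ (fun l h0 h1 => ?_) hw
  have := act_mem_component (m₁ := m₁) (m₂ := m₂) (i :: l)
  rw [count_cons, h0, h1] at this
  exact this

theorem chevH_act (i : Fin 2) (l : List (Fin 2)) :
    ∃ r : ℂ, ⁅chevH i, (act (l.map chevF) : Verma m₁ m₂)⁆ = r • act (l.map chevF) := by
  induction l with
  | nil => exact ⟨_, chevH_hwv i⟩
  | cons j l ih =>
    obtain ⟨r, hr⟩ := ih
    refine ⟨-cartan i j + r, ?_⟩
    rw [List.map_cons, act_cons, leibniz_lie, lie_chevH_chevF, hr, lie_smul, smul_lie, add_smul]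

theorem chevE_act (i : Fin 2) (l : List (Fin 2)) :
    ⁅chevE i, (act (l.map chevF) : Verma m₁ m₂)⁆ ∈
      ⨆ γ : {γ : ℕ × ℕ // deg i + γ = (l.count 0, l.count 1)}, component m₁ m₂ γ.1 := by
  induction l with
  | nil =>
    have : ⁅chevE i, (act (([] : List (Fin 2)).map chevF) : Verma m₁ m₂)⁆ = 0 := chevE_hwv i
    rw [this]
    exact Submodule.zero_mem _
  | cons j l ih =>
    rw [List.map_cons, act_cons, leibniz_lie, lie_chevE_chevF, count_cons]
    refine Submodule.add_mem _ ?_ ?_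
    · split_ifs with hij
      · subst hij
        obtain ⟨r, hr⟩ := chevH_act (m₁ := m₁) (m₂ := m₂) i l
        rw [hr]
        exact Submodule.smul_mem _ _ (Submodule.mem_iSup_of_mem ⟨_, rfl⟩ (act_mem_component l))
      · simp
    · generalize ⁅chevE i, (act (l.map chevF) : Verma m₁ m₂)⁆ = u at ih
      induction ih using Submodule.iSup_induction' with
      | mem γ w hw =>
        refine Submodule.mem_iSup_of_mem ⟨deg j + γ.1, ?_⟩ (chevF_component j hw)
        rw [add_left_comm]
        exact congrArg (deg j + ·) γ.2
      | zero => simp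
      | add w w' _ _ hw hw' => rw [lie_add]; exact Submodule.add_mem _ hw hw'

/-- `x` preserves the finiteness of the support of functionals. -/
def Good (m₁ m₂ : ℂ) (x : AffSl2) : Prop := ∀ φ : Module.Dual ℂ (Verma m₁ m₂),
  FiniteSupport φ → FiniteSupport (φ ∘ₗ (LieModule.toEnd ℂ AffSl2 (Verma m₁ m₂) x))

theorem Good.add {x y : AffSl2} (hx : Good m₁ m₂ x) (hy : Good m₁ m₂ y) : Good m₁ m₂ (x + y) := by
  intro φ hφ
  have := (Contragredient m₁ m₂).add_mem (hx φ hφ) (hy φ hφ)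
  rwa [← LinearMap.comp_add, ← map_add] at this

theorem Good.smul {x : AffSl2} (r : ℂ) (hx : Good m₁ m₂ x) : Good m₁ m₂ (r • x) := by
  intro φ hφ
  have := (Contragredient m₁ m₂).smul_mem r (hx φ hφ)
  rwa [← LinearMap.comp_smul, ← map_smul] at this

theorem Good.lie {x y : AffSl2} (hx : Good m₁ m₂ x) (hy : Good m₁ m₂ y) : Good m₁ m₂ ⁅x, y⁆ := by
  intro φ hφ
  have := (Contragredient m₁ m₂).sub_mem (hy _ (hx φ hφ)) (hx _ (hy φ hφ))
  refine (congrArg FiniteSupport ?_).mp this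
  ext w
  simp

theorem good_chevF (i : Fin 2) : Good m₁ m₂ (chevF i) := by
  intro φ hφ
  have hinj : Function.Injective (fun γ : ℕ × ℕ => deg i + γ) := fun a b hab => by simpa using hab
  refine (hφ.preimage hinj.injOn).subset ?_
  rintro γ ⟨w, hw, hne⟩
  exact ⟨_, chevF_component i hw, hne⟩

theorem good_chevE (i : Fin 2) : Good m₁ m₂ (chevE i) := by
  intro φ hφ
  refine (hφ.image (fun γ : ℕ × ℕ => deg i + γ)).subset ?_
  rintro γ ⟨w, hw, hne⟩
  by_contra hcon
  apply hne
  change φ ⁅chevE i, w⁆ = 0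
  rw [← LinearMap.mem_ker]
  refine component_le _ (fun l h0 h1 => ?_) hw
  refine (iSup_le ?_ : _ ≤ LinearMap.ker φ) (chevE_act i l)
  rintro ⟨γ', hγ'⟩ w' hw'
  rw [LinearMap.mem_ker]
  by_contra h3
  refine hcon ⟨γ', ⟨w', hw', h3⟩, ?_⟩
  change deg i + γ' = γ
  rw [hγ', h0, h1]

theorem good_all (x : AffSl2) : Good m₁ m₂ x := by
  have he : Good m₁ m₂ (loop 0 e) := good_chevE 0
  have hf : Good m₁ m₂ (loop 0 f) := good_chevF 0
  have hef : traceForm e f = 1 := by simp [traceForm_apply, e, f, Matrix.trace_fin_two]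
  have hhe : traceForm h e = 0 := by simp [traceForm_apply, e, h, Matrix.trace_fin_two]
  have hhf : traceForm h f = 0 := by simp [traceForm_apply, f, h, Matrix.trace_fin_two]
  have hh (n : ℤ) (hn : Good m₁ m₂ (loop n f)) : Good m₁ m₂ (loop n h) := by
    have := he.lie hn
    simpa [lie_loop_loop, lie_e_f] using this
  have hh1 : Good m₁ m₂ (loop 1 h) := hh 1 (good_chevE 1)
  have hh2 : Good m₁ m₂ (loop (-1) h) := by
    have := (good_chevF (m₁ := m₁) (m₂ := m₂) 1).lie hf
    have h2 := Good.add this (Good.smul 0 hf)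
    simpa [chevF, lie_loop_loop, lie_e_f] using h2
  have hfn (n : ℤ) : Good m₁ m₂ (loop n f) := by
    induction n using Int.induction_on with
    | zero => exact hf
    | succ n ih =>
      have := (hh1.lie ih).smul (-2)⁻¹
      rw [lie_loop_loop, lie_h_f, hhf] at this
      simpa [add_comm] using this
    | pred n ih =>
      have := (hh2.lie ih).smul (-2)⁻¹
      rw [lie_loop_loop, lie_h_f, hhf] at this
      simpa [sub_eq_add_neg, add_comm] using this
  have hen (n : ℤ) : Good m₁ m₂ (loop n e) := by
    induction n using Int.induction_on with
    | zero => exact he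
    | succ n ih =>
      have := (hh1.lie ih).smul 2⁻¹
      rw [lie_loop_loop, lie_h_e, hhe] at this
      simpa [add_comm] using this
    | pred n ih =>
      have := (hh2.lie ih).smul 2⁻¹
      rw [lie_loop_loop, lie_h_e, hhe] at this
      simpa [sub_eq_add_neg, add_comm] using this
  have hc : Good m₁ m₂ c := by
    have h1 := (hen 1).lie (hfn (-1))
    have h2 := h1.add ((hh 0 hf).smul (-1))
    simpa [lie_loop_loop, lie_e_f, hef] using h2
  induction x using affSl2_induction with
  | hadd x y hx hy => exact hx.add hy
  | hsmul r x hx => exact hx.smul r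
  | hc => exact hc
  | hloop n a =>
    rw [sl2_eq a, map_add, map_add, map_smul, map_smul, map_smul]
    exact (((hen n).smul _).add ((hfn n).smul _)).add ((hh n (hfn n)).smul _)

theorem finiteSupport_comp (x : AffSl2) (φ : Module.Dual ℂ (Verma m₁ m₂)) (hφ : FiniteSupport φ) :
    FiniteSupport (φ ∘ₗ (LieModule.toEnd ℂ AffSl2 (Verma m₁ m₂) x)) :=
  good_all x φ hφ

/-- The affine Lie algebra acts on `V*` through the Chevalley anti-involution:
`⟨x φ, w⟩ = ⟨φ, chev x w⟩`. -/
instance : LieRingModule AffSl2 (Contragredient m₁ m₂) where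
  bracket x φ := ⟨φ.1 ∘ₗ LieModule.toEnd ℂ AffSl2 (Verma m₁ m₂) (chev x),
    finiteSupport_comp (chev x) φ.1 φ.2⟩
  add_lie x y φ := by
    apply Subtype.ext; ext w; simp
  lie_add x φ ψ := by
    apply Subtype.ext; ext w; simp
  leibniz_lie x y φ := by
    apply Subtype.ext; ext w
    simp [chev_lie]

instance : LieModule ℂ AffSl2 (Contragredient m₁ m₂) where
  smul_lie r x φ := by
    apply Subtype.ext; ext w
    change φ.1 ⁅chev (r • x), w⁆ = r • φ.1 ⁅chev x, w⁆
    simp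
  lie_smul r x φ := by
    apply Subtype.ext; ext w
    rfl

theorem lie_contragredient_apply (x : AffSl2) (φ : Contragredient m₁ m₂) (w : Verma m₁ m₂) :
    (⁅x, φ⁆ : Contragredient m₁ m₂).1 w = φ.1 ⁅chev x, w⁆ := rfl

/-- The defining formula `⟨fᵢ φ, w⟩ = ⟨φ, eᵢ w⟩`. -/
theorem chevF_contragredient (i : Fin 2) (φ : Contragredient m₁ m₂) (w : Verma m₁ m₂) :
    (⁅chevF i, φ⁆ : Contragredient m₁ m₂).1 w = φ.1 ⁅chevE i, w⁆ := by
  rw [lie_contragredient_apply, chev_chevF]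

/-- The defining formula `⟨eᵢ φ, w⟩ = ⟨φ, fᵢ w⟩`. -/
theorem chevE_contragredient (i : Fin 2) (φ : Contragredient m₁ m₂) (w : Verma m₁ m₂) :
    (⁅chevE i, φ⁆ : Contragredient m₁ m₂).1 w = φ.1 ⁅chevF i, w⁆ := by
  rw [lie_contragredient_apply, chev_chevE]

/-! ### Bases and dual bases -/

/-- The element `x / Tⁿ` of the affine Lie algebra. -/
def divT (x : Sl2) (n : ℕ) : AffSl2 := loop (-(n : ℤ)) x

variable (m₁ m₂) in
/-- The chosen basis of `V_γ`. For `γ.1 > γ.2` it consists of the vectors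
`f/T^{i₁} ⋯ f/T^{i_a} h/T^{j₁} ⋯ h/T^{j_b} e/T^{k₁} ⋯ e/T^{k_c} v` of degree `γ` with weakly
decreasing `i`, `j`, `k`, with `i ≥ 0` and `j, k ≥ 1`; for `γ.1 < γ.2` of the same vectors with
the `e`-factors to the left and the `f`-factors to the right. On the diagonal `γ.1 = γ.2`, where
only `V_0 = ℂ v` with basis `v` is of interest, the first order is used. -/
def chosenBasis (γ : ℕ × ℕ) : Set (Verma m₁ m₂) :=
  {w | ∃ I J K : List ℕ, I.Pairwise (· ≥ ·) ∧ J.Pairwise (· ≥ ·) ∧ K.Pairwise (· ≥ ·) ∧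
    (∀ j ∈ J, 1 ≤ j) ∧ (∀ k ∈ K, 1 ≤ k) ∧
    I.sum + J.sum + K.sum + I.length = γ.1 + K.length ∧ I.sum + J.sum + K.sum = γ.2 ∧
    w = if γ.1 < γ.2 then act (K.map (divT e) ++ J.map (divT h) ++ I.map (divT f))
      else act (I.map (divT f) ++ J.map (divT h) ++ K.map (divT e))}

/-- `φ ∈ V*` is the covector dual to the chosen basis vector `w` of some component `V_γ`: it takes
the value `1` on `w`, vanishes on the other chosen basis vectors of `V_γ`, and vanishes on all the
other components. -/
def IsDualTo (w : Verma m₁ m₂) (φ : Contragredient m₁ m₂) : Prop :=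
  ∃ γ : ℕ × ℕ, w ∈ chosenBasis m₁ m₂ γ ∧ φ.1 w = 1 ∧
    (∀ w' ∈ chosenBasis m₁ m₂ γ, w' ≠ w → φ.1 w' = 0) ∧
    ∀ γ' : ℕ × ℕ, γ' ≠ γ → ∀ w' ∈ component m₁ m₂ γ', φ.1 w' = 0

/-- The covector `(w)*` of the dual basis, for a chosen basis vector `w`. -/
def dualVec (w : Verma m₁ m₂) : Contragredient m₁ m₂ := Classical.epsilon (IsDualTo w)

end Verma

end AffineSl2

end

open AffineSl2

open AffineSl2

/-!
The identities compare functionals on the Verma module `V`, and the comparison rests on the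
Poincaré–Birkhoff–Witt theorem for `V`. For every order on the root vectors of the negative part,
the ordered monomials applied to `v` form a basis of `V` (`pbw`). They span by the usual
straightening argument, which also respects the `ℕ × ℕ`-grading (`word_mem_span`). They are
independent because the affine Lie algebra acts on the free space on the ordered monomials with
`v ↦ 1`; this action is constructed in `InducedModule.op`, for any Lie algebra with a basis adapted
to a subalgebra and a character of that subalgebra, and it is a representation by
`InducedModule.compat`. Each chosen basis is the part of degree `γ` of one of the two bases
belonging to the orders `f < h < e` and `e < h < f` (`chosenBasis_eq`). Hence the dual covectors
exist, are unique, and are coordinate functionals (`existsUnique_isDualTo`, `dualVec_pbw`).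

For the first identity use the order `f < h < e`. The operators `f/Tⁿ`, `n ≥ 0`, commute and act on
ordered monomials by multiplication. Let `φ`, `ψ d`, `Q d` be the coordinate of `1`, the coordinate
of `f/Tᵈ`, and the sum of the coordinates of all `f/Tⁱ f/Tʲ` with `i + j = d`. They satisfy
`φ (f/Tⁿ w) = 0`, `ψ d (f/Tⁿ w) = δ φ w` and `Q d (f/Tⁿ w) = ψ (d - n) w`. With the commutation
relations these rules suffice to evaluate both sides of the identity on a vector of the form
`f/Tⁿ y` (`functional_identity`). The sum over `l` yields two sums of values `ψ d (f Tʲ y)`, which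
cancel after a shift of `l`. The terms left over by the shift vanish unless `n = a - 1`, when they
account for the difference between `m + (a - 1) k`, which comes from the commutator of `e Tᵃ⁻¹` and
`f/Tᵃ⁻¹`, and the coefficient `m + (a - 1) (k + 2)`. The remaining ordered monomials contain no
factor `f/Tⁿ`, and on them both sides vanish by their weight under `h` (`coord_identity`).

The second identity is the first one for the order `e < h < f`, after the automorphism that
exchanges the two Chevalley generators of each kind: `f Tʲ`, `e Tʲ`, `h Tʲ` are replaced by
`e Tʲ⁻¹`, `f Tʲ⁺¹`, `-h Tʲ + δ c`, where `δ` is `1` if `j = 0` and `0` otherwise, and `m` by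
`k - m`. Both are therefore instances of `dualVec_identity`, in
which a Boolean `o` selects the order.
-/

noncomputable section

/-! ### Modules induced from a character, by the method of Poincaré, Birkhoff and Witt -/

namespace InducedModule

open Finsupp

variable {K L ι κ : Type*} [CommRing K] [LieRing L] [LieAlgebra K L]

/-- The leading term of `x_s · z_M` in the induced module: `z_{s + M}` if `s` is an index of the
complement, and `0` if `s` is an index of the subalgebra. -/
def leadingTerm (K : Type*) [CommRing K] (s : ι ⊕ κ) (M : Multiset ι) : Multiset ι →₀ K :=
  s.elim (fun i => single (i ::ₘ M) 1) (fun _ => 0)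

/-- The span of the monomials of degree at most `n`. -/
def degLE (K ι : Type*) [CommRing K] (n : ℕ) : Submodule K (Multiset ι →₀ K) :=
  supported K K {M : Multiset ι | M.card ≤ n}

theorem single_mem_degLE {M : Multiset ι} {n : ℕ} (h : M.card ≤ n) :
    (single M 1 : Multiset ι →₀ K) ∈ degLE K ι n :=
  single_mem_supported K _ h

theorem degLE_mono {n m : ℕ} (h : n ≤ m) : degLE K ι n ≤ degLE K ι m :=
  supported_mono fun _ hM => le_trans hM h

theorem degLE_induction {n : ℕ} {S : Submodule K (Multiset ι →₀ K)}
    (h : ∀ M : Multiset ι, M.card ≤ n → single M 1 ∈ S) : degLE K ι n ≤ S := by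
  rw [degLE, supported_eq_span_single, Submodule.span_le]
  rintro _ ⟨M, hM, rfl⟩
  exact h M hM

theorem leadingTerm_mem (s : ι ⊕ κ) (M : Multiset ι) :
    leadingTerm K s M ∈ degLE K ι (M.card + 1) := by
  rcases s with i | p
  · exact single_mem_degLE (by simp)
  · exact Submodule.zero_mem _

variable [LinearOrder ι]

/-- The smallest element of a nonempty multiset. -/
def least (M : Multiset ι) (hM : M ≠ 0) : ι :=
  M.toFinset.min' (Multiset.toFinset_nonempty.mpr hM)

theorem least_mem {M : Multiset ι} (hM : M ≠ 0) : least M hM ∈ M :=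
  Multiset.mem_toFinset.mp (Finset.min'_mem _ _)

theorem least_le {M : Multiset ι} (hM : M ≠ 0) {i : ι} (hi : i ∈ M) : least M hM ≤ i :=
  Finset.min'_le _ _ (Multiset.mem_toFinset.mpr hi)

theorem least_cons {j : ι} {N : Multiset ι} (hj : ∀ i ∈ N, j ≤ i) (h : j ::ₘ N ≠ 0) :
    least (j ::ₘ N) h = j := by
  refine le_antisymm (least_le h (Multiset.mem_cons_self _ _)) ?_
  rcases Multiset.mem_cons.mp (least_mem h) with h' | h'
  · exact h'.ge
  · exact hj _ h'

open Classical in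
/-- The vector `x · z_M` of the induced module, as a linear function of `x`. With `M = j + N`, where
`j` is the least element of `M`, and for a basis element `x_s` with `s` not below `j`, it is
`x_j (x_s z_N) + [x_s, x_j] z_N`; here the leading term of `x_s z_N` is treated separately, because
only vectors of degree less than that of `z_M` are available to the recursion. -/
def vec (b : Module.Basis (ι ⊕ κ) K L) (lam : κ → K) (M : Multiset ι) : L →ₗ[K] (Multiset ι →₀ K) :=
  if h : M = 0 then
    b.constr K fun s => leadingTerm K s 0 + s.elim (fun _ => 0) (fun p => lam p • single 0 1)
  else
    have : (M.erase (least M h)).card < M.card := by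
      rw [Multiset.card_erase_of_mem (least_mem h)]
      exact Nat.pred_lt (by simpa using h)
    b.constr K fun s =>
      if ∃ i ≤ least M h, s = Sum.inl i then leadingTerm K s M
      else leadingTerm K s M +
        linearCombination K
          (fun M' => if M'.card < M.card then vec b lam M' (b (Sum.inl (least M h))) else 0)
          (vec b lam (M.erase (least M h)) (b s) - leadingTerm K s (M.erase (least M h))) +
        vec b lam (M.erase (least M h)) ⁅b s, b (Sum.inl (least M h))⁆
termination_by M.card

variable (b : Module.Basis (ι ⊕ κ) K L) (lam : κ → K)

/-- The action of `L` on the induced module. -/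
def op : L →ₗ[K] (Multiset ι →₀ K) →ₗ[K] (Multiset ι →₀ K) :=
  b.constr K fun s => linearCombination K fun M => vec b lam M (b s)

theorem op_single (x : L) (M : Multiset ι) : op b lam x (single M 1) = vec b lam M x := by
  suffices h : (LinearMap.applyₗ (single M 1 : Multiset ι →₀ K)) ∘ₗ op b lam = vec b lam M from
    LinearMap.congr_fun h x
  refine b.ext fun s => ?_
  simp [op, Module.Basis.constr_basis]

theorem op_zero_inl (i : ι) : op b lam (b (Sum.inl i)) (single 0 1) = single {i} 1 := by
  rw [op_single, vec, dif_pos rfl, Module.Basis.constr_basis]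
  simp [leadingTerm]

theorem op_zero_inr (p : κ) :
    op b lam (b (Sum.inr p)) (single 0 1) = lam p • single 0 1 := by
  rw [op_single, vec, dif_pos rfl, Module.Basis.constr_basis]
  simp [leadingTerm]

theorem op_of_le {i : ι} {M : Multiset ι} (hi : ∀ j ∈ M, i ≤ j) :
    op b lam (b (Sum.inl i)) (single M 1) = single (i ::ₘ M) 1 := by
  by_cases h : M = 0
  · subst h; simpa using op_zero_inl b lam i
  · rw [op_single, vec, dif_neg h]
    simp only [Module.Basis.constr_basis]
    rw [if_pos ⟨i, hi _ (least_mem h), rfl⟩, leadingTerm, Sum.elim_inl]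

/-- The recursion, with the truncation replaced by the action itself; `hw` says that the truncation
is harmless. -/
theorem op_cons_aux {j : ι} {N : Multiset ι} (hj : ∀ i ∈ N, j ≤ i) {s : ι ⊕ κ}
    (hs : ¬ ∃ i ≤ j, s = Sum.inl i)
    (hw : op b lam (b s) (single N 1) - leadingTerm K s N ∈ degLE K ι N.card) :
    op b lam (b s) (single (j ::ₘ N) 1) = leadingTerm K s (j ::ₘ N) +
      op b lam (b (Sum.inl j)) (op b lam (b s) (single N 1) - leadingTerm K s N) +
      op b lam ⁅b s, b (Sum.inl j)⁆ (single N 1) := by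
  have h : j ::ₘ N ≠ 0 := Multiset.cons_ne_zero
  have hl := least_cons hj h
  conv_lhs => rw [op_single, vec, dif_neg h]
  simp only [Module.Basis.constr_basis, hl, Multiset.erase_cons_head]
  rw [if_neg (by rwa [hl]), ← op_single, ← op_single]
  congr 2
  rw [degLE, supported_eq_span_single] at hw
  generalize op b lam (b s) (single N 1) - leadingTerm K s N = w at hw
  induction hw using Submodule.span_induction with
  | mem w hw =>
    obtain ⟨M, hM, rfl⟩ := hw
    have hM' : M.card < (j ::ₘ N).card := by
      rw [Multiset.card_cons]; exact Nat.lt_succ_of_le hM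
    rw [linearCombination_single, one_smul, if_pos hM', op_single]
  | zero => simp
  | add w w' _ _ hw hw' => rw [map_add, map_add, hw, hw']
  | smul r w _ hw => rw [map_smul, map_smul, hw]

/-- Up to terms of lower degree, `x_s` acts on a monomial by its leading term. -/
theorem op_sub_leadingTerm_mem (s : ι ⊕ κ) (M : Multiset ι) :
    op b lam (b s) (single M 1) - leadingTerm K s M ∈ degLE K ι M.card := by
  induction hn : M.card using Nat.strong_induction_on generalizing M s with
  | _ n ih =>
  subst hn
  have hop (x : L) (n : ℕ) (hn : n < M.card) (w) (hw : w ∈ degLE K ι n) :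
      op b lam x w ∈ degLE K ι (n + 1) := by
    refine (degLE_induction (S := (degLE K ι (n + 1)).comap (op b lam x)) fun N hN => ?_) hw
    rw [Submodule.mem_comap]
    induction b.mem_span x using Submodule.span_induction with
    | mem x hx =>
      obtain ⟨s, rfl⟩ := hx
      have h1 := ih _ (hN.trans_lt hn) s N rfl
      have h2 := Submodule.add_mem _ (degLE_mono (Nat.le_succ _) h1) (leadingTerm_mem s N)
      rw [sub_add_cancel] at h2
      exact degLE_mono (Nat.succ_le_succ hN) h2
    | zero => simp
    | add x y _ _ hx hy => rw [map_add, LinearMap.add_apply]; exact Submodule.add_mem _ hx hy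
    | smul r x _ hx => rw [map_smul, LinearMap.smul_apply]; exact Submodule.smul_mem _ r hx
  by_cases h : M = 0
  · subst h
    rcases s with i | p
    · rw [op_zero_inl]; simp [leadingTerm]
    · rw [op_zero_inr]
      rw [leadingTerm, Sum.elim_inr, sub_zero]
      exact Submodule.smul_mem _ _ (single_mem_degLE le_rfl)
  · have hM := Multiset.cons_erase (least_mem h)
    have hle : ∀ i ∈ M.erase (least M h), least M h ≤ i :=
      fun i hi => least_le h (Multiset.mem_of_mem_erase hi)
    set j := least M h
    set N := M.erase j
    have hcard : N.card + 1 = M.card := by rw [← hM, Multiset.card_cons]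
    by_cases hs : ∃ i ≤ j, s = Sum.inl i
    · obtain ⟨i, hi, rfl⟩ := hs
      rw [op_of_le b lam fun k hk => hi.trans (least_le h hk)]
      simp [leadingTerm]
    · have hN := ih N.card (by omega) s N rfl
      rw [← hM, op_cons_aux b lam hle hs hN, add_assoc, add_sub_cancel_left, Multiset.card_cons]
      exact Submodule.add_mem _ (hop _ _ (by omega) _ hN)
        (hop _ _ (by omega) _ (single_mem_degLE le_rfl))

/-- `x` and `y` act on `w` compatibly with the bracket. -/
def Compat (x y : L) (w : Multiset ι →₀ K) : Prop :=
  op b lam x (op b lam y w) - op b lam y (op b lam x w) = op b lam ⁅x, y⁆ w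

variable {b lam}

theorem Compat.symm {x y : L} {w : Multiset ι →₀ K} (h : Compat b lam x y w) :
    Compat b lam y x w := by
  unfold Compat at h ⊢
  rw [← lie_skew, map_neg, LinearMap.neg_apply, ← h, neg_sub]

theorem Compat.add {x y : L} {w w' : Multiset ι →₀ K} (h : Compat b lam x y w)
    (h' : Compat b lam x y w') : Compat b lam x y (w + w') := by
  unfold Compat at h h' ⊢
  simp only [map_add, ← h, ← h']
  abel

theorem Compat.of_basis {w : Multiset ι →₀ K} (h : ∀ s t, Compat b lam (b s) (b t) w) (x y : L) :
    Compat b lam x y w := by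
  unfold Compat at h ⊢
  induction b.mem_span x using Submodule.span_induction with
  | mem x hx =>
    obtain ⟨s, rfl⟩ := hx
    induction b.mem_span y using Submodule.span_induction with
    | mem y hy => obtain ⟨t, rfl⟩ := hy; exact h s t
    | zero => simp
    | add y y' _ _ hy hy' =>
      simp only [map_add, LinearMap.add_apply, lie_add, ← hy, ← hy']; abel
    | smul r y _ hy =>
      simp only [map_smul, LinearMap.smul_apply, lie_smul, ← hy, smul_sub]
  | zero => simp
  | add x x' _ _ hx hx' =>
    simp only [map_add, LinearMap.add_apply, add_lie, ← hx, ← hx']; abel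
  | smul r x _ hx => simp only [map_smul, LinearMap.smul_apply, smul_lie, ← hx, smul_sub]

theorem Compat.of_degLE {n : ℕ} {x y : L}
    (h : ∀ M : Multiset ι, M.card ≤ n → Compat b lam x y (single M 1)) {w : Multiset ι →₀ K}
    (hw : w ∈ degLE K ι n) : Compat b lam x y w := by
  let T := op b lam x ∘ₗ op b lam y - op b lam y ∘ₗ op b lam x - op b lam ⁅x, y⁆
  have hT (w) : Compat b lam x y w ↔ w ∈ LinearMap.ker T := by
    rw [LinearMap.mem_ker, Compat, ← sub_eq_zero]; rfl
  rw [hT]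
  exact degLE_induction (fun M hM => (hT _).mp (h M hM)) hw

/-- By construction, `x_s` and `x_j` act compatibly on a monomial all of whose factors are at
least `j`, if `s` is not below `j`. -/
theorem compat_of_le {j : ι} {N : Multiset ι} (hj : ∀ i ∈ N, j ≤ i) {s : ι ⊕ κ}
    (hs : ¬ ∃ i < j, s = Sum.inl i) : Compat b lam (b s) (b (Sum.inl j)) (single N 1) := by
  by_cases hsj : s = Sum.inl j
  · subst hsj; simp [Compat]
  have hs' : ¬ ∃ i ≤ j, s = Sum.inl i := by
    rintro ⟨i, hi, rfl⟩
    exact hs ⟨i, lt_of_le_of_ne hi (by simpa using hsj), rfl⟩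
  have hlead : op b lam (b (Sum.inl j)) (leadingTerm K s N) = leadingTerm K s (j ::ₘ N) := by
    rcases s with i | p
    · simp only [leadingTerm, Sum.elim_inl]
      have hij : j ≤ i := by
        by_contra hcon
        exact hs ⟨i, not_le.mp hcon, rfl⟩
      rw [op_of_le, Multiset.cons_swap]
      intro k hk
      rcases Multiset.mem_cons.mp hk with rfl | hk
      · exact hij
      · exact hj k hk
    · simp [leadingTerm]
  unfold Compat
  rw [op_of_le b lam hj, op_cons_aux b lam hj hs' (op_sub_leadingTerm_mem b lam s N), map_sub,
    hlead]
  abel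

/-- The inductive step: if everything acts compatibly on `w`, and the pairs `x, u` and `y, u` act
compatibly on `y w` and `x w`, then `x, y` act compatibly on `u w`, by the Jacobi identity. -/
theorem compat_op {x y u : L} {w : Multiset ι →₀ K} (h : ∀ x y, Compat b lam x y w)
    (hx : Compat b lam x u (op b lam y w)) (hy : Compat b lam y u (op b lam x w)) :
    Compat b lam x y (op b lam u w) := by
  have e1 := h y u
  have e2 := h x u
  have e3 := h x ⁅y, u⁆
  have e4 := h y ⁅x, u⁆
  have e5 := h ⁅x, y⁆ u
  have e6 := h x y
  have jac : ⁅⁅x, y⁆, u⁆ = ⁅x, ⁅y, u⁆⁆ - ⁅y, ⁅x, u⁆⁆ := by rw [leibniz_lie x y u]; abel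
  unfold Compat at *
  rw [jac, map_sub, LinearMap.sub_apply] at e5
  have e1' := congrArg (op b lam x) e1
  have e2' := congrArg (op b lam y) e2
  have e6' := congrArg (op b lam u) e6
  simp only [map_sub] at e1' e2' e6'
  linear_combination (norm := module) e1' - e2' + hx - hy + e3 - e4 + e6' - e5

/-- The operators `op` represent the Lie algebra, if `lam` is a character of the subalgebra. -/
theorem compat (hsub : ∀ p q i, b.repr ⁅b (Sum.inr p), b (Sum.inr q)⁆ (Sum.inl i) = 0)
    (hlam : ∀ p q, b.constr K (Sum.elim 0 lam) ⁅b (Sum.inr p), b (Sum.inr q)⁆ = 0) (x y : L)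
    (w : Multiset ι →₀ K) : Compat b lam x y w := by
  suffices h : ∀ (M : Multiset ι) (x y), Compat b lam x y (single M 1) by
    let n := w.support.sup Multiset.card
    have hw : w ∈ degLE K ι n := by
      rw [degLE, mem_supported]
      exact fun M hM => Finset.le_sup (f := Multiset.card) hM
    exact Compat.of_degLE (fun M _ => h M x y) hw
  intro M
  induction hn : M.card using Nat.strong_induction_on generalizing M with
  | _ n ih =>
  subst hn
  refine Compat.of_basis fun s t => ?_
  -- A pair containing an index at most `M` is covered by `compat_of_le`, up to exchanging the two.
  have key (s t : ι ⊕ κ) (j : ι) (hj : ∀ i ∈ M, j ≤ i) (hs : s = Sum.inl j) :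
      Compat b lam (b s) (b t) (single M 1) := by
    subst hs
    by_cases ht : ∃ i < j, t = Sum.inl i
    · obtain ⟨i, hi, rfl⟩ := ht
      refine compat_of_le (fun k hk => hi.le.trans (hj k hk)) ?_
      rintro ⟨k, hk, hk'⟩
      exact lt_asymm hi (Sum.inl_injective hk' ▸ hk)
    · exact (compat_of_le hj ht).symm
  by_cases h : M = 0
  · subst h
    rcases s with i | p
    · exact key _ _ i (by simp) rfl
    rcases t with i | q
    · exact (key _ _ i (by simp) rfl).symm
    have hz : op b lam ⁅b (Sum.inr p), b (Sum.inr q)⁆ (single 0 1) = 0 := by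
      have (z : L) (hz : ∀ i, b.repr z (Sum.inl i) = 0) : op b lam z (single 0 1) =
          b.constr K (Sum.elim 0 lam) z • (single 0 1 : Multiset ι →₀ K) := by
        conv_lhs => rw [← b.linearCombination_repr z]
        rw [Module.Basis.constr_apply, linearCombination_apply, Finsupp.sum, Finsupp.sum, map_sum,
          LinearMap.sum_apply, Finset.sum_smul]
        refine Finset.sum_congr rfl fun s _ => ?_
        rcases s with i | p
        · simp [hz i]
        · rw [map_smul, LinearMap.smul_apply, op_zero_inr, smul_assoc]; rfl
      rw [this _ (hsub p q), hlam, zero_smul]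
    unfold Compat
    rw [hz, op_zero_inr, op_zero_inr, map_smul, map_smul, op_zero_inr, op_zero_inr, smul_comm,
      sub_self]
  · have hM := Multiset.cons_erase (least_mem h)
    have hle : ∀ i ∈ M.erase (least M h), least M h ≤ i :=
      fun i hi => least_le h (Multiset.mem_of_mem_erase hi)
    have hlM : ∀ i ∈ M, least M h ≤ i := fun i hi => least_le h hi
    set j := least M h
    set N := M.erase j
    have hcard : N.card < M.card := by rw [← hM, Multiset.card_cons]; omega
    by_cases hs : ∃ i ≤ j, s = Sum.inl i
    · obtain ⟨i, hi, rfl⟩ := hs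
      exact key _ _ i (fun k hk => hi.trans (hlM k hk)) rfl
    by_cases ht : ∃ i ≤ j, t = Sum.inl i
    · obtain ⟨i, hi, rfl⟩ := ht
      exact (key _ _ i (fun k hk => hi.trans (hlM k hk)) rfl).symm
    have step (s t : ι ⊕ κ) (hs : ¬ ∃ i ≤ j, s = Sum.inl i) (ht : ¬ ∃ i ≤ j, t = Sum.inl i) :
        Compat b lam (b s) (b (Sum.inl j)) (op b lam (b t) (single N 1)) := by
      rw [← sub_add_cancel (op b lam (b t) (single N 1)) (leadingTerm K t N)]
      refine Compat.add (Compat.of_degLE (fun M' hM' => ih _ (hM'.trans_lt hcard) M' rfl _ _)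
        (op_sub_leadingTerm_mem b lam t N)) ?_
      rcases t with i | p
      · refine compat_of_le (fun k hk => ?_) fun ⟨i, hi, hi'⟩ => hs ⟨i, hi.le, hi'⟩
        rcases Multiset.mem_cons.mp hk with rfl | hk
        · by_contra hcon
          exact ht ⟨k, (not_le.mp hcon).le, rfl⟩
        · exact hle k hk
      · simp [leadingTerm, Compat]
    rw [← hM, ← op_of_le b lam hle]
    exact compat_op (ih _ hcard N rfl) (step s t hs ht) (step t s ht hs)

attribute [local instance] LieRing.ofAssociativeRing

/-- The induced module as a representation of `L`. -/
def rep (hsub : ∀ p q i, b.repr ⁅b (Sum.inr p), b (Sum.inr q)⁆ (Sum.inl i) = 0)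
    (hlam : ∀ p q, b.constr K (Sum.elim 0 lam) ⁅b (Sum.inr p), b (Sum.inr q)⁆ = 0) :
    L →ₗ⁅K⁆ Module.End K (Multiset ι →₀ K) :=
  { op b lam with
    map_lie' := fun {x y} => LinearMap.ext fun w => Eq.symm (compat hsub hlam x y w) }

end InducedModule

/-! ### A triangular basis of the affine Lie algebra -/

namespace AffineSl2

theorem traceForm_e_f : traceForm e f = 1 := by
  simp [traceForm_apply, e, f, Matrix.trace_fin_two]

theorem traceForm_e_e : traceForm e e = 0 := by
  simp [traceForm_apply, e, Matrix.trace_fin_two]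

theorem traceForm_f_f : traceForm f f = 0 := by
  simp [traceForm_apply, f, Matrix.trace_fin_two]

theorem traceForm_h_e : traceForm h e = 0 := by
  simp [traceForm_apply, e, h, Matrix.trace_fin_two]

theorem traceForm_h_f : traceForm h f = 0 := by
  simp [traceForm_apply, f, h, Matrix.trace_fin_two]

theorem lie_loop_e_f (i j : ℤ) :
    ⁅loop i e, loop j f⁆ = loop (i + j) h + (if i + j = 0 then (i : ℂ) else 0) • c := by
  rw [lie_loop_loop, lie_e_f, traceForm_e_f, mul_one]

theorem lie_loop_f_e (i j : ℤ) :
    ⁅loop i f, loop j e⁆ = -loop (i + j) h + (if i + j = 0 then (i : ℂ) else 0) • c := by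
  rw [lie_loop_loop, ← lie_skew, lie_e_f, traceForm_comm, traceForm_e_f, mul_one, map_neg]

theorem lie_loop_h_e (i j : ℤ) : ⁅loop i h, loop j e⁆ = (2 : ℂ) • loop (i + j) e := by
  simp [lie_loop_loop, lie_h_e, traceForm_h_e]

theorem lie_loop_e_h (i j : ℤ) : ⁅loop i e, loop j h⁆ = (-2 : ℂ) • loop (i + j) e := by
  rw [← lie_skew, lie_loop_h_e, add_comm j i, neg_smul]

theorem lie_loop_h_f (i j : ℤ) : ⁅loop i h, loop j f⁆ = (-2 : ℂ) • loop (i + j) f := by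
  simp [lie_loop_loop, lie_h_f, traceForm_h_f]

theorem lie_loop_f_h (i j : ℤ) : ⁅loop i f, loop j h⁆ = (2 : ℂ) • loop (i + j) f := by
  rw [← lie_skew, lie_loop_h_f, add_comm j i, neg_smul, neg_neg]

theorem lie_loop_e_e (i j : ℤ) : ⁅loop i e, loop j e⁆ = 0 := by
  simp [lie_loop_loop, traceForm_e_e]

theorem lie_loop_f_f (i j : ℤ) : ⁅loop i f, loop j f⁆ = 0 := by
  simp [lie_loop_loop, traceForm_f_f]

theorem lie_loop_h_h (i j : ℤ) (hij : i + j = 0 → i = 0) : ⁅loop i h, loop j h⁆ = 0 := by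
  rw [lie_loop_loop, lie_self, map_zero, zero_add]
  split_ifs with h0
  · simp [hij h0]
  · simp

theorem c_lie (x : AffSl2) : ⁅c, x⁆ = 0 := by rw [← lie_skew, lie_c, neg_zero]

/-- Indices for the basis of the negative part: `f n`, `h n`, `e n` stand for `f/Tⁿ`, `h/Tⁿ⁺¹`,
`e/Tⁿ⁺¹`. -/
inductive NegIdx : Type
  | f (n : ℕ)
  | h (n : ℕ)
  | e (n : ℕ)

/-- Indices for the basis of the nonnegative part: `e n`, `h n`, `f n` stand for `e Tⁿ`, `h Tⁿ`,
`f Tⁿ⁺¹`, and `c` for the central element. -/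
inductive PosIdx : Type
  | e (n : ℕ)
  | h (n : ℕ)
  | f (n : ℕ)
  | c

/-- The basis vectors of the negative part. -/
def negGen : NegIdx → AffSl2
  | .f n => divT f n
  | .h n => divT h (n + 1)
  | .e n => divT e (n + 1)

/-- The basis vectors of the nonnegative part. -/
def posGen : PosIdx → AffSl2
  | .e n => loop n e
  | .h n => loop n h
  | .f n => loop (n + 1) f
  | .c => c

/-- The coefficient of `Tⁿ`, an element of `sl₂`. -/
def loopCoeff (n : ℤ) : AffSl2 →ₗ[ℂ] Sl2 where
  toFun x := LieAlgebra.LoopAlgebra.toFinsupp ℂ ℤ Sl2 ((LieAlgebra.ofProd cocycle).symm x).1 n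
  map_add' x y := by simp
  map_smul' r x := by simp

/-- The coefficient of the central element. -/
def centralCoeff : AffSl2 →ₗ[ℂ] ℂ where
  toFun x := TrivialLieModule.equiv ℂ LoopSl2 ℂ ((LieAlgebra.ofProd cocycle).symm x).2
  map_add' x y := by simp
  map_smul' r x := by simp

theorem loopCoeff_loop (n i : ℤ) (a : Sl2) : loopCoeff n (loop i a) = if i = n then a else 0 := by
  change LieAlgebra.LoopAlgebra.toFinsupp ℂ ℤ Sl2 (AddMonoidAlgebra.single i 1 ⊗ₜ[ℂ] a) n = _
  rw [LieAlgebra.LoopAlgebra.toFinsupp_single_tmul, Finsupp.single_apply]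

theorem loopCoeff_c (n : ℤ) : loopCoeff n c = 0 := by
  change LieAlgebra.LoopAlgebra.toFinsupp ℂ ℤ Sl2 0 n = _
  simp

theorem centralCoeff_loop (i : ℤ) (a : Sl2) : centralCoeff (loop i a) = 0 := by
  change TrivialLieModule.equiv ℂ LoopSl2 ℂ 0 = 0
  simp

theorem centralCoeff_c : centralCoeff c = 1 := by
  change TrivialLieModule.equiv ℂ LoopSl2 ℂ ((TrivialLieModule.equiv ℂ LoopSl2 ℂ).symm 1) = 1
  simp

/-- A matrix entry, as a functional on `sl₂`. -/
def entry (i j : Fin 2) : Sl2 →ₗ[ℂ] ℂ where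
  toFun a := a.1 i j
  map_add' a b := by simp
  map_smul' r a := by simp

/-- The coordinate functionals dual to the vectors `negGen` and `posGen`. -/
def genCoord : NegIdx ⊕ PosIdx → Module.Dual ℂ AffSl2
  | .inl (.f n) => entry 1 0 ∘ₗ loopCoeff (-(n : ℤ))
  | .inl (.h n) => entry 0 0 ∘ₗ loopCoeff (-((n + 1 : ℕ) : ℤ))
  | .inl (.e n) => entry 0 1 ∘ₗ loopCoeff (-((n + 1 : ℕ) : ℤ))
  | .inr (.e n) => entry 0 1 ∘ₗ loopCoeff n
  | .inr (.h n) => entry 0 0 ∘ₗ loopCoeff n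
  | .inr (.f n) => entry 1 0 ∘ₗ loopCoeff (n + 1)
  | .inr .c => centralCoeff

theorem entry_e (i j : Fin 2) : entry i j e = if i = 0 ∧ j = 1 then 1 else 0 := by
  fin_cases i <;> fin_cases j <;> simp [entry, e]

theorem entry_f (i j : Fin 2) : entry i j f = if i = 1 ∧ j = 0 then 1 else 0 := by
  fin_cases i <;> fin_cases j <;> simp [entry, f]

theorem entry_h (i j : Fin 2) :
    entry i j h = if i = 0 ∧ j = 0 then 1 else if i = 1 ∧ j = 1 then -1 else 0 := by
  fin_cases i <;> fin_cases j <;> simp [entry, h]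

theorem genCoord_gen (s t : NegIdx ⊕ PosIdx) [Decidable (s = t)] :
    genCoord s (Sum.elim negGen posGen t) = if s = t then 1 else 0 := by
  rcases s with (n | n | n) | (n | n | n | _) <;> rcases t with (k | k | k) | (k | k | k | _) <;>
    simp only [genCoord, Sum.elim_inl, Sum.elim_inr, negGen, posGen, divT, LinearMap.comp_apply,
      loopCoeff_loop, loopCoeff_c, centralCoeff_loop, centralCoeff_c, apply_ite (entry _ _),
      entry_e, entry_f, entry_h, map_zero, reduceCtorEq, Sum.inl.injEq, Sum.inr.injEq,
      NegIdx.f.injEq, NegIdx.h.injEq, NegIdx.e.injEq, PosIdx.f.injEq, PosIdx.h.injEq,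
      PosIdx.e.injEq] <;>
    split_ifs <;> first | rfl | omega | simp_all

theorem linearIndependent_gen : LinearIndependent ℂ (Sum.elim negGen posGen) := by
  classical
  refine LinearIndependent.of_pairwise_dual_eq_zero_one _ genCoord (fun s t hst => ?_) fun s => ?_
  · exact (genCoord_gen s t).trans (if_neg hst)
  · rw [genCoord_gen, if_pos rfl]

theorem span_gen : ⊤ ≤ Submodule.span ℂ (Set.range (Sum.elim negGen posGen)) := by
  have hmem (s) : Sum.elim negGen posGen s ∈
      Submodule.span ℂ (Set.range (Sum.elim negGen posGen)) := Submodule.subset_span ⟨s, rfl⟩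
  rintro x -
  induction x using affSl2_induction with
  | hadd x y hx hy => exact Submodule.add_mem _ hx hy
  | hsmul r x hx => exact Submodule.smul_mem _ r hx
  | hc => exact hmem (.inr .c)
  | hloop n a =>
    rw [sl2_eq a]
    simp only [map_add, map_smul]
    refine Submodule.add_mem _ (Submodule.add_mem _ (Submodule.smul_mem _ _ ?_)
      (Submodule.smul_mem _ _ ?_)) (Submodule.smul_mem _ _ ?_)
    · rcases lt_or_ge n 0 with hn | hn
      · convert hmem (.inl (.e (-n - 1).toNat)) using 1
        simp only [Sum.elim_inl, negGen, divT]
        congr 2; omega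
      · convert hmem (.inr (.e n.toNat)) using 1
        simp only [Sum.elim_inr, posGen]
        congr 2; omega
    · rcases le_or_gt n 0 with hn | hn
      · convert hmem (.inl (.f (-n).toNat)) using 1
        simp only [Sum.elim_inl, negGen, divT]
        congr 2; omega
      · convert hmem (.inr (.f (n - 1).toNat)) using 1
        simp only [Sum.elim_inr, posGen]
        congr 2; omega
    · rcases lt_or_ge n 0 with hn | hn
      · convert hmem (.inl (.h (-n - 1).toNat)) using 1
        simp only [Sum.elim_inl, negGen, divT]
        congr 2; omega
      · convert hmem (.inr (.h n.toNat)) using 1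
        simp only [Sum.elim_inr, posGen]
        congr 2; omega

/-- The basis of the affine Lie algebra adapted to its decomposition into the negative and the
nonnegative part. -/
def genBasis : Module.Basis (NegIdx ⊕ PosIdx) ℂ AffSl2 :=
  Module.Basis.mk linearIndependent_gen span_gen

theorem genBasis_inl (i : NegIdx) : genBasis (.inl i) = negGen i := by simp [genBasis]

theorem genBasis_inr (p : PosIdx) : genBasis (.inr p) = posGen p := by simp [genBasis]

/-- The character of the nonnegative part by which it acts on the generator of `V(m₁, m₂)`. -/
def weight (m₁ m₂ : ℂ) : PosIdx → ℂ
  | .h 0 => m₁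
  | .c => m₁ + m₂
  | _ => 0

theorem lie_posGen (m₁ m₂ : ℂ) (p q : PosIdx) :
    ∃ (r : ℂ) (s : PosIdx), ⁅posGen p, posGen q⁆ = r • posGen s ∧ weight m₁ m₂ s = 0 := by
  have zero {x : AffSl2} (hx : x = 0) :
      ∃ (r : ℂ) (s : PosIdx), x = r • posGen s ∧ weight m₁ m₂ s = 0 :=
    ⟨0, .e 0, by rw [hx, zero_smul], rfl⟩
  rcases p with i | i | i | _ <;> rcases q with j | j | j | _ <;> simp only [posGen]
  · exact zero (lie_loop_e_e _ _)
  · exact ⟨-2, .e (i + j), by rw [lie_loop_e_h]; simp, rfl⟩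
  · refine ⟨1, .h (i + j + 1), ?_, rfl⟩
    rw [lie_loop_e_f, if_neg (by omega)]; simp [add_assoc]
  · exact zero (lie_c _)
  · exact ⟨2, .e (i + j), by rw [lie_loop_h_e]; simp, rfl⟩
  · exact zero (lie_loop_h_h _ _ (by omega))
  · exact ⟨-2, .f (i + j), by rw [lie_loop_h_f]; simp [add_assoc], rfl⟩
  · exact zero (lie_c _)
  · refine ⟨-1, .h (i + j + 1), ?_, rfl⟩
    rw [lie_loop_f_e, if_neg (by omega)]; simp [add_right_comm]
  · exact ⟨2, .f (i + j), by rw [lie_loop_f_h]; simp [add_right_comm], rfl⟩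
  · exact zero (lie_loop_f_f _ _)
  · exact zero (lie_c _)
  all_goals exact zero (c_lie _)

/-- The `ℕ × ℕ`-degree of the basis vectors of the negative part: the numbers of factors `f₁` and
`f₂`. -/
def negDeg : NegIdx → ℕ × ℕ
  | .f n => (n + 1, n)
  | .h n => (n + 1, n + 1)
  | .e n => (n, n + 1)

theorem lie_negGen (i j : NegIdx) : ⁅negGen i, negGen j⁆ = 0 ∨
    ∃ (r : ℂ) (s : NegIdx), ⁅negGen i, negGen j⁆ = r • negGen s ∧
      negDeg s = negDeg i + negDeg j := by
  rcases i with i | i | i <;> rcases j with j | j | j <;> simp only [negGen, divT]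
  · exact .inl (lie_loop_f_f _ _)
  · refine .inr ⟨2, .f (i + j + 1), ?_, ?_⟩
    · rw [lie_loop_f_h]; congr 3; omega
    · simp only [negDeg, Prod.mk_add_mk, Prod.mk.injEq]; omega
  · refine .inr ⟨-1, .h (i + j), ?_, ?_⟩
    · rw [lie_loop_f_e, if_neg (by omega), zero_smul, add_zero, neg_smul, one_smul]
      congr 3; omega
    · simp only [negDeg, Prod.mk_add_mk, Prod.mk.injEq]; omega
  · refine .inr ⟨-2, .f (i + j + 1), ?_, ?_⟩
    · rw [lie_loop_h_f]; congr 3; omega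
    · simp only [negDeg, Prod.mk_add_mk, Prod.mk.injEq]; omega
  · exact .inl (lie_loop_h_h _ _ (by omega))
  · refine .inr ⟨2, .e (i + j + 1), ?_, ?_⟩
    · rw [lie_loop_h_e]; congr 3
    · simp only [negDeg, Prod.mk_add_mk, Prod.mk.injEq]; omega
  · refine .inr ⟨1, .h (i + j), ?_, ?_⟩
    · rw [lie_loop_e_f, if_neg (by omega), zero_smul, add_zero, one_smul]
      congr 2; omega
    · simp only [negDeg, Prod.mk_add_mk, Prod.mk.injEq]; omega
  · refine .inr ⟨-2, .e (i + j + 1), ?_, ?_⟩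
    · rw [lie_loop_e_h]; congr 3
    · simp only [negDeg, Prod.mk_add_mk, Prod.mk.injEq]; omega
  · exact .inl (lie_loop_e_e _ _)

variable {m₁ m₂ : ℂ}

/-! ### Words in the negative generators -/

/-- The vector of the Verma module given by a word in the basis vectors of the negative part. -/
def word (l : List NegIdx) : Verma m₁ m₂ := act (l.map negGen)

theorem word_nil : (word [] : Verma m₁ m₂) = hwv m₁ m₂ := rfl

theorem word_cons (i : NegIdx) (l : List NegIdx) :
    (word (i :: l) : Verma m₁ m₂) = ⁅negGen i, word l⁆ := rfl

/-- The degree of a multiset of indices. -/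
def degSum (M : Multiset NegIdx) : ℕ × ℕ := (M.map negDeg).sum

theorem degSum_cons (i : NegIdx) (M : Multiset NegIdx) :
    degSum (i ::ₘ M) = negDeg i + degSum M := by simp [degSum]

theorem degSum_coe_cons (i : NegIdx) (l : List NegIdx) :
    degSum ↑(i :: l) = negDeg i + degSum ↑l := degSum_cons i l

theorem negDeg_ne_zero (i : NegIdx) : negDeg i ≠ 0 := by
  rcases i with n | n | n <;> simp [negDeg]

theorem degSum_eq_zero {M : Multiset NegIdx} : degSum M = 0 ↔ M = 0 := by
  refine ⟨fun h => ?_, fun h => by rw [h]; rfl⟩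
  by_contra hM
  obtain ⟨i, hi⟩ := Multiset.exists_mem_of_ne_zero hM
  obtain ⟨N, rfl⟩ := Multiset.exists_cons_of_mem hi
  rw [degSum_cons, add_eq_zero] at h
  exact negDeg_ne_zero i h.1

variable (m₁ m₂) in
/-- The span of the words of degree `γ` and of length less than `n`. -/
def shortWords (n : ℕ) (γ : ℕ × ℕ) : Submodule ℂ (Verma m₁ m₂) :=
  Submodule.span ℂ {w | ∃ l : List NegIdx, l.length < n ∧ degSum ↑l = γ ∧ w = word l}

theorem lie_shortWords (i : NegIdx) {n : ℕ} {γ : ℕ × ℕ} {w : Verma m₁ m₂}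
    (hw : w ∈ shortWords m₁ m₂ n γ) : ⁅negGen i, w⁆ ∈ shortWords m₁ m₂ (n + 1) (negDeg i + γ) := by
  induction hw using Submodule.span_induction with
  | mem w hw =>
    obtain ⟨l, hl, hd, rfl⟩ := hw
    exact Submodule.subset_span ⟨i :: l, by simpa using hl, by rw [degSum_coe_cons, hd], rfl⟩
  | zero => simp
  | add w w' _ _ hw hw' => rw [lie_add]; exact Submodule.add_mem _ hw hw'
  | smul r w _ hw => rw [lie_smul]; exact Submodule.smul_mem _ r hw

/-- Permuting the letters changes a word by shorter words only. -/
theorem word_sub_mem_of_perm {l l' : List NegIdx} (h : l.Perm l') :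
    (word l - word l' : Verma m₁ m₂) ∈ shortWords m₁ m₂ l.length (degSum ↑l) := by
  induction h with
  | nil => simp
  | cons i _ ih =>
    rw [word_cons, word_cons, ← lie_sub, degSum_coe_cons]
    exact lie_shortWords i ih
  | swap i j l =>
    have hswap : (word (j :: i :: l) - word (i :: j :: l) : Verma m₁ m₂) =
        ⁅⁅negGen j, negGen i⁆, (word l : Verma m₁ m₂)⁆ := by
      simp only [word_cons, lie_lie]
    rw [hswap]
    rcases lie_negGen j i with h0 | ⟨r, s, hr, hd⟩
    · simp [h0]
    · rw [hr, smul_lie]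
      refine Submodule.smul_mem _ _ (Submodule.subset_span ⟨s :: l, by simp, ?_, rfl⟩)
      rw [degSum_coe_cons, degSum_coe_cons, degSum_coe_cons, hd, add_assoc]
  | trans h₁ _ ih₁ ih₂ =>
    rw [← h₁.length_eq, ← Multiset.coe_eq_coe.mpr h₁] at ih₂
    simpa using Submodule.add_mem _ ih₁ ih₂

/-! ### Action of the affine Lie algebra on the generator -/

theorem loop_zero_h_hwv : ⁅loop 0 h, hwv m₁ m₂⁆ = m₁ • hwv m₁ m₂ := by
  simpa [chevH] using chevH_hwv (m₁ := m₁) (m₂ := m₂) 0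

theorem c_hwv : ⁅c, hwv m₁ m₂⁆ = (m₁ + m₂) • hwv m₁ m₂ := by
  have h1 := chevH_hwv (m₁ := m₁) (m₂ := m₂) 1
  simp only [chevH, Matrix.cons_val_one, Matrix.cons_val_fin_one, sub_lie, loop_zero_h_hwv] at h1
  rw [add_smul, ← h1]
  abel

/-- The Verma module is generated by `hwv`. -/
theorem eq_top_of_lie_mem {W : Submodule ℂ (Verma m₁ m₂)} (hv : hwv m₁ m₂ ∈ W)
    (hW : ∀ (x : AffSl2), ∀ w ∈ W, ⁅x, w⁆ ∈ W) : W = ⊤ := by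
  have hU (u : UniversalEnvelopingAlgebra ℂ AffSl2) {w} (hw : w ∈ W) : u • w ∈ W := by
    obtain ⟨t, rfl⟩ : ∃ t, UniversalEnvelopingAlgebra.mkAlgHom ℂ AffSl2 t = u :=
      RingCon.mkₐ_surjective _ u
    induction t using TensorAlgebra.induction generalizing w with
    | algebraMap r => rw [AlgHom.commutes, algebraMap_smul]; exact Submodule.smul_mem _ r hw
    | ι x => exact hW x w hw
    | mul a b ha hb => rw [map_mul, mul_smul]; exact ha (hb hw)
    | add a b ha hb => rw [map_add, add_smul]; exact Submodule.add_mem _ (ha hw) (hb hw)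
  rw [eq_top_iff]
  rintro w -
  obtain ⟨u, rfl⟩ := Submodule.Quotient.mk_surjective _ w
  have hu : (Submodule.Quotient.mk u : Verma m₁ m₂) = u • hwv m₁ m₂ := by
    change _ = (vermaIdeal m₁ m₂).mkQ (u • 1)
    rw [smul_eq_mul, mul_one]; rfl
  exact hu ▸ hU u hv

theorem c_lie_verma (w : Verma m₁ m₂) : ⁅c, w⁆ = (m₁ + m₂) • w := by
  let W : Submodule ℂ (Verma m₁ m₂) :=
    LinearMap.ker (LieModule.toEnd ℂ AffSl2 (Verma m₁ m₂) c - (m₁ + m₂) • LinearMap.id)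
  have hmem (w) : w ∈ W ↔ ⁅c, w⁆ = (m₁ + m₂) • w := by
    rw [LinearMap.mem_ker]; exact sub_eq_zero
  have hW : W = ⊤ := by
    refine eq_top_of_lie_mem ((hmem _).mpr c_hwv) fun x w hw => (hmem _).mpr ?_
    rw [leibniz_lie, c_lie, zero_lie, zero_add, (hmem w).mp hw, lie_smul]
  exact (hmem w).mp (hW ▸ Submodule.mem_top)

theorem loop_e_hwv (n : ℕ) : ⁅loop n e, hwv m₁ m₂⁆ = 0 ∧ ⁅loop (n + 1) f, hwv m₁ m₂⁆ = 0 := by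
  have he : ⁅loop 0 e, hwv m₁ m₂⁆ = 0 := chevE_hwv 0
  have hf : ⁅loop 1 f, hwv m₁ m₂⁆ = 0 := chevE_hwv 1
  have hh : ⁅loop 1 h, hwv m₁ m₂⁆ = 0 := by
    have h1 : loop 1 h = ⁅loop 0 e, loop 1 f⁆ := by simp [lie_loop_e_f]
    rw [h1, lie_lie, hf, he]; simp
  induction n with
  | zero => simpa using ⟨he, hf⟩
  | succ n ih =>
    have h1 : loop ((n + 1 : ℕ) : ℤ) e = (2 : ℂ)⁻¹ • ⁅loop 1 h, loop (n : ℤ) e⁆ := by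
      rw [lie_loop_h_e, smul_smul]; simp [add_comm]
    have h2 : loop ((n + 1 : ℕ) + 1 : ℤ) f = (-2 : ℂ)⁻¹ • ⁅loop 1 h, loop (n + 1 : ℤ) f⁆ := by
      rw [lie_loop_h_f, smul_smul]; simp [add_comm]
    rw [h1, h2, smul_lie, smul_lie, lie_lie, lie_lie, ih.1, ih.2, hh]
    simp

theorem posGen_hwv (p : PosIdx) : ⁅posGen p, hwv m₁ m₂⁆ = weight m₁ m₂ p • hwv m₁ m₂ := by
  rcases p with n | n | n | _
  · simpa [posGen, weight] using (loop_e_hwv n).1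
  · rcases n with _ | n
    · simpa [posGen, weight] using loop_zero_h_hwv
    · have h1 : loop ((n + 1 : ℕ) : ℤ) h = ⁅loop 0 e, loop (n + 1 : ℤ) f⁆ := by
        rw [lie_loop_e_f, if_neg (by omega)]; simp
      have he := (loop_e_hwv (m₁ := m₁) (m₂ := m₂) 0).1
      simp only [Nat.cast_zero] at he
      simp only [posGen, weight, zero_smul]
      rw [h1, lie_lie, he, (loop_e_hwv n).2]
      simp
  · simpa [posGen, weight] using (loop_e_hwv n).2
  · exact c_hwv

/-- The words span the Verma module. -/
theorem span_word : Submodule.span ℂ (Set.range (word : List NegIdx → Verma m₁ m₂)) = ⊤ := by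
  set W := Submodule.span ℂ (Set.range (word : List NegIdx → Verma m₁ m₂))
  have hword (l) : word l ∈ W := Submodule.subset_span ⟨l, rfl⟩
  have hneg (i) {w} (hw : w ∈ W) : ⁅negGen i, w⁆ ∈ W := by
    induction hw using Submodule.span_induction with
    | mem w hw => obtain ⟨l, rfl⟩ := hw; exact hword (i :: l)
    | zero => simp
    | add w w' _ _ hw hw' => rw [lie_add]; exact Submodule.add_mem _ hw hw'
    | smul r w _ hw => rw [lie_smul]; exact Submodule.smul_mem _ r hw
  have hx (l : List NegIdx) : ∀ x : AffSl2, ⁅x, word l⁆ ∈ W := by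
    have of_gen (l : List NegIdx) (hl : ∀ p, ⁅posGen p, word l⁆ ∈ W) (x : AffSl2) : ⁅x, word l⁆ ∈ W := by
      induction genBasis.mem_span x using Submodule.span_induction with
      | mem x hx =>
        obtain ⟨i | p, rfl⟩ := hx
        · rw [genBasis_inl]; exact hneg i (hword l)
        · rw [genBasis_inr]; exact hl p
      | zero => simp
      | add x y _ _ hx hy => rw [add_lie]; exact Submodule.add_mem _ hx hy
      | smul r x _ hx => rw [smul_lie]; exact Submodule.smul_mem _ r hx
    induction l with
    | nil =>
      refine of_gen _ fun p => ?_
      rw [word_nil, posGen_hwv]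
      exact Submodule.smul_mem _ _ (hword [])
    | cons i l ih =>
      refine of_gen _ fun p => ?_
      rw [word_cons, leibniz_lie]
      exact Submodule.add_mem _ (ih _) (hneg i (ih _))
  have hW (x : AffSl2) {w} (hw : w ∈ W) : ⁅x, w⁆ ∈ W := by
    induction hw using Submodule.span_induction with
    | mem w hw => obtain ⟨l, rfl⟩ := hw; exact hx l x
    | zero => simp
    | add w w' _ _ hw hw' => rw [lie_add]; exact Submodule.add_mem _ hw hw'
    | smul r w _ hw => rw [lie_smul]; exact Submodule.smul_mem _ r hw
  exact eq_top_of_lie_mem (hword []) fun x w hw => hW x hw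

/-! ### Words and homogeneous components -/

/-- `x` shifts the grading of the Verma module by `d`. -/
def Shifts (m₁ m₂ : ℂ) (x : AffSl2) (d : ℕ × ℕ) : Prop :=
  ∀ γ, ∀ w ∈ component m₁ m₂ γ, ⁅x, w⁆ ∈ component m₁ m₂ (d + γ)

theorem Shifts.smul {x : AffSl2} {d : ℕ × ℕ} (hx : Shifts m₁ m₂ x d) (r : ℂ) :
    Shifts m₁ m₂ (r • x) d := fun γ w hw => by
  rw [smul_lie]; exact Submodule.smul_mem _ r (hx γ w hw)

theorem Shifts.lie {x y : AffSl2} {d d' : ℕ × ℕ} (hx : Shifts m₁ m₂ x d)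
    (hy : Shifts m₁ m₂ y d') : Shifts m₁ m₂ ⁅x, y⁆ (d + d') := fun γ w hw => by
  rw [lie_lie]
  refine Submodule.sub_mem _ ?_ ?_
  · rw [add_assoc]; exact hx _ _ (hy _ _ hw)
  · rw [add_comm d, add_assoc]; exact hy _ _ (hx _ _ hw)

theorem shifts_negGen (i : NegIdx) : Shifts m₁ m₂ (negGen i) (negDeg i) := by
  have hf0 : Shifts m₁ m₂ (loop 0 f) (1, 0) := fun γ w hw => chevF_component 0 hw
  have he0 : Shifts m₁ m₂ (loop (-1) e) (0, 1) := fun γ w hw => chevF_component 1 hw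
  have hh0 : Shifts m₁ m₂ (loop (-1) h) (1, 1) := by
    have := he0.lie hf0
    rw [lie_loop_e_f, if_neg (by omega)] at this
    simpa using this
  have hf (n : ℕ) : Shifts m₁ m₂ (loop (-(n : ℤ)) f) (n + 1, n) := by
    induction n with
    | zero => simpa using hf0
    | succ n ih =>
      have := (hh0.lie ih).smul (-2)⁻¹
      rw [lie_loop_h_f, smul_smul, inv_mul_cancel₀ (by norm_num), one_smul, Prod.mk_add_mk] at this
      convert this using 1
      · congr 2; omega
      · simp only [Prod.mk.injEq]; omega
  have he (n : ℕ) : Shifts m₁ m₂ (loop (-((n + 1 : ℕ) : ℤ)) e) (n, n + 1) := by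
    induction n with
    | zero => simpa using he0
    | succ n ih =>
      have := (hh0.lie ih).smul 2⁻¹
      rw [lie_loop_h_e, smul_smul, inv_mul_cancel₀ (by norm_num), one_smul, Prod.mk_add_mk] at this
      convert this using 1
      · congr 2; omega
      · simp only [Prod.mk.injEq]; omega
  rcases i with n | n | n
  · exact hf n
  · have := he0.lie (hf n)
    rw [lie_loop_e_f, if_neg (by omega), zero_smul, add_zero, Prod.mk_add_mk] at this
    convert this using 1
    · simp only [negGen, divT]; congr 2; omega
    · simp only [negDeg, Prod.mk.injEq]; omega
  · exact he n

theorem word_mem_component (l : List NegIdx) :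
    (word l : Verma m₁ m₂) ∈ component m₁ m₂ (degSum ↑l) := by
  induction l with
  | nil => exact act_mem_component []
  | cons i l ih =>
    rw [degSum_coe_cons]
    exact shifts_negGen i _ _ ih

/-- The index of the generator `fᵢ`. -/
def chevIdx : Fin 2 → NegIdx := ![.f 0, .e 0]

theorem act_chevF (l : List (Fin 2)) :
    (act (l.map chevF) : Verma m₁ m₂) = word (l.map chevIdx) ∧
      degSum ↑(l.map chevIdx) = (l.count 0, l.count 1) := by
  induction l with
  | nil => exact ⟨rfl, rfl⟩
  | cons i l ih =>
    have hi : chevF i = negGen (chevIdx i) ∧ deg i = negDeg (chevIdx i) := by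
      fin_cases i <;> simp [chevF, chevIdx, negGen, divT, deg, negDeg]
    rw [List.map_cons, List.map_cons, act_cons, word_cons, degSum_coe_cons, count_cons, ih.1, ih.2,
      hi.1, hi.2]
    exact ⟨rfl, rfl⟩

/-! ### Bases of ordered monomials -/

/-- The indices of the negative part with one of two orders: for `o = false` the order
`f < h < e`, for `o = true` the order `e < h < f`. In both, a larger power of `T⁻¹` comes first
among the multiples of the same generator. -/
def Idx (_o : Bool) : Type := NegIdx

/-- The position of an index in the order given by `o`. -/
def orderKey : Bool → NegIdx → ℕ ×ₗ ℕᵒᵈ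
  | false, .f n => toLex (0, OrderDual.toDual n)
  | false, .h n => toLex (1, OrderDual.toDual n)
  | false, .e n => toLex (2, OrderDual.toDual n)
  | true, .e n => toLex (0, OrderDual.toDual n)
  | true, .h n => toLex (1, OrderDual.toDual n)
  | true, .f n => toLex (2, OrderDual.toDual n)

theorem orderKey_injective (o : Bool) : Function.Injective (orderKey o) := by
  rintro (i | i | i) (j | j | j) <;> cases o <;> simp [orderKey]

instance (o : Bool) : LinearOrder (Idx o) := LinearOrder.lift' (orderKey o) (orderKey_injective o)

theorem Idx.le_iff {o : Bool} {i j : Idx o} : i ≤ j ↔ orderKey o i ≤ orderKey o j := Iff.rfl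

/-- `genBasis`, for the index type with order. -/
def idxBasis (o : Bool) : Module.Basis (Idx o ⊕ PosIdx) ℂ AffSl2 := genBasis

theorem idxBasis_inl (o : Bool) (i : Idx o) : idxBasis o (.inl i) = negGen i := genBasis_inl i

theorem idxBasis_inr (o : Bool) (p : PosIdx) : idxBasis o (.inr p) = posGen p := genBasis_inr p

attribute [local instance] LieRing.ofAssociativeRing

variable (m₁ m₂) in
/-- The representation of the affine Lie algebra on the space with basis the ordered monomials. -/
def monomialRep (o : Bool) : AffSl2 →ₗ⁅ℂ⁆ Module.End ℂ (Multiset (Idx o) →₀ ℂ) :=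
  InducedModule.rep (b := idxBasis o) (lam := weight m₁ m₂)
    (fun p q i => by
      obtain ⟨r, s, hr, -⟩ := lie_posGen m₁ m₂ p q
      rw [idxBasis_inr, idxBasis_inr, hr, ← idxBasis_inr o, map_smul, Module.Basis.repr_self]
      simp)
    (fun p q => by
      obtain ⟨r, s, hr, hs⟩ := lie_posGen m₁ m₂ p q
      rw [idxBasis_inr, idxBasis_inr, hr, ← idxBasis_inr o, map_smul, Module.Basis.constr_basis,
        Sum.elim_inr, hs, smul_zero])

theorem monomialRep_apply (o : Bool) (x : AffSl2) :
    monomialRep m₁ m₂ o x = InducedModule.op (idxBasis o) (weight m₁ m₂) x := rfl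

theorem monomialRep_of_le (o : Bool) {i : Idx o} {M : Multiset (Idx o)} (hi : ∀ j ∈ M, i ≤ j) :
    monomialRep m₁ m₂ o (negGen i) (Finsupp.single M 1) = Finsupp.single (i ::ₘ M) 1 := by
  rw [monomialRep_apply, ← idxBasis_inl o]
  exact InducedModule.op_of_le _ _ hi

theorem monomialRep_posGen (o : Bool) (p : PosIdx) :
    monomialRep m₁ m₂ o (posGen p) (Finsupp.single 0 1) =
      weight m₁ m₂ p • Finsupp.single 0 1 := by
  rw [monomialRep_apply, ← idxBasis_inr o]
  exact InducedModule.op_zero_inr _ _ p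

variable (m₁ m₂) in
/-- The linear map from the enveloping algebra given by acting on the empty monomial. -/
def envToMonomial (o : Bool) :
    UniversalEnvelopingAlgebra ℂ AffSl2 →ₗ[ℂ] (Multiset (Idx o) →₀ ℂ) :=
  LinearMap.applyₗ (Finsupp.single 0 1) ∘ₗ
    (UniversalEnvelopingAlgebra.lift ℂ (monomialRep m₁ m₂ o)).toLinearMap

theorem envToMonomial_mul (o : Bool) (u u' : UniversalEnvelopingAlgebra ℂ AffSl2) :
    envToMonomial m₁ m₂ o (u * u') =
      UniversalEnvelopingAlgebra.lift ℂ (monomialRep m₁ m₂ o) u (envToMonomial m₁ m₂ o u') := by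
  simp [envToMonomial]

theorem envToMonomial_eq_zero (o : Bool) {u : UniversalEnvelopingAlgebra ℂ AffSl2}
    (hu : u ∈ vermaIdeal m₁ m₂) : envToMonomial m₁ m₂ o u = 0 := by
  have hι (x : AffSl2) : envToMonomial m₁ m₂ o (UniversalEnvelopingAlgebra.ι ℂ x) =
      monomialRep m₁ m₂ o x (Finsupp.single 0 1) := by
    simp only [envToMonomial, LinearMap.comp_apply, AlgHom.toLinearMap_apply,
      UniversalEnvelopingAlgebra.lift_ι_apply]
    rfl
  have hr (r : ℂ) : envToMonomial m₁ m₂ o (algebraMap ℂ _ r) = r • Finsupp.single 0 1 := by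
    simp only [envToMonomial, LinearMap.comp_apply, AlgHom.toLinearMap_apply, AlgHom.commutes]
    rfl
  have hh := monomialRep_posGen (m₁ := m₁) (m₂ := m₂) o (.h 0)
  have hc := monomialRep_posGen (m₁ := m₁) (m₂ := m₂) o .c
  induction hu using Submodule.span_induction with
  | mem u hu =>
    rcases hu with rfl | rfl | rfl | rfl
    · rw [hι]
      simpa [posGen, weight, chevE] using monomialRep_posGen (m₁ := m₁) (m₂ := m₂) o (.e 0)
    · rw [hι]
      simpa [posGen, weight, chevE] using monomialRep_posGen (m₁ := m₁) (m₂ := m₂) o (.f 0)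
    · rw [map_sub, hι, hr, sub_eq_zero]
      exact hh
    · rw [map_sub, hι, hr, sub_eq_zero]
      change monomialRep m₁ m₂ o (c - loop 0 h) _ = _
      rw [map_sub, LinearMap.sub_apply]
      refine (congrArg₂ (· - ·) hc hh).trans ?_
      simp only [weight]
      rw [← sub_smul]; ring_nf
  | zero => simp
  | add u u' _ _ hu hu' => rw [map_add, hu, hu', add_zero]
  | smul a u _ hu => rw [smul_eq_mul, envToMonomial_mul, hu, map_zero]

variable (m₁ m₂) in
/-- The homomorphism from the Verma module to the space with basis the ordered monomials. -/
def toMonomial (o : Bool) : Verma m₁ m₂ →ₗ[ℂ] (Multiset (Idx o) →₀ ℂ) :=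
  (Submodule.liftQ ((vermaIdeal m₁ m₂).restrictScalars ℂ) (envToMonomial m₁ m₂ o)
      fun _ hu => envToMonomial_eq_zero o hu) ∘ₗ
    (Submodule.Quotient.restrictScalarsEquiv ℂ (vermaIdeal m₁ m₂)).symm.toLinearMap

theorem toMonomial_hwv (o : Bool) : toMonomial m₁ m₂ o (hwv m₁ m₂) = Finsupp.single 0 1 := by
  change envToMonomial m₁ m₂ o 1 = _
  simp [envToMonomial]

theorem toMonomial_lie (o : Bool) (x : AffSl2) (w : Verma m₁ m₂) :
    toMonomial m₁ m₂ o ⁅x, w⁆ = monomialRep m₁ m₂ o x (toMonomial m₁ m₂ o w) := by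
  obtain ⟨u, rfl⟩ := Submodule.Quotient.mk_surjective _ w
  change envToMonomial m₁ m₂ o (UniversalEnvelopingAlgebra.ι ℂ x * u) =
    monomialRep m₁ m₂ o x (envToMonomial m₁ m₂ o u)
  rw [envToMonomial_mul, UniversalEnvelopingAlgebra.lift_ι_apply]

theorem toMonomial_word (o : Bool) {l : List (Idx o)} (hl : l.Pairwise (· ≤ ·)) :
    toMonomial m₁ m₂ o (word l) = Finsupp.single (l : Multiset (Idx o)) 1 := by
  induction l with
  | nil => exact toMonomial_hwv o
  | cons i l ih =>
    rw [List.pairwise_cons] at hl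
    change toMonomial m₁ m₂ o ⁅negGen i, word l⁆ = _
    rw [toMonomial_lie, ih hl.2, monomialRep_of_le o (by simpa using hl.1), Multiset.cons_coe]

/-- The ordered monomial with the given multiset of factors. -/
def sortedWord (o : Bool) (M : Multiset (Idx o)) : Verma m₁ m₂ := word M.sort

theorem sort_coe_of_pairwise {o : Bool} {l : List (Idx o)} (hl : l.Pairwise (· ≤ ·)) :
    (l : Multiset (Idx o)).sort = l :=
  List.Perm.eq_of_pairwise' (r := (· ≤ ·)) (Multiset.pairwise_sort _ _) hl
    (Multiset.coe_eq_coe.mp (Multiset.sort_eq _ _))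

theorem sortedWord_coe {o : Bool} {l : List (Idx o)} (hl : l.Pairwise (· ≤ ·)) :
    (sortedWord o l : Verma m₁ m₂) = word l := by
  rw [sortedWord, sort_coe_of_pairwise hl]

/-- Every word is a combination of ordered monomials of the same degree. -/
theorem word_mem_span (o : Bool) (l : List NegIdx) :
    (word l : Verma m₁ m₂) ∈ Submodule.span ℂ (sortedWord o '' {M | degSum M = degSum ↑l}) := by
  induction hn : l.length using Nat.strong_induction_on generalizing l with
  | _ n ih =>
  subst hn
  let k : List (Idx o) := l
  have hsort : ((k : Multiset (Idx o)).sort).Perm k :=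
    Multiset.coe_eq_coe.mp (Multiset.sort_eq (k : Multiset (Idx o)) _)
  have h1 := word_sub_mem_of_perm (m₁ := m₁) (m₂ := m₂) hsort.symm
  have h2 : shortWords m₁ m₂ l.length (degSum ↑l) ≤
      Submodule.span ℂ (sortedWord o '' {M | degSum M = degSum ↑l}) := by
    refine Submodule.span_le.mpr ?_
    rintro _ ⟨l', hlen, hdeg, rfl⟩
    rw [← hdeg]
    exact ih _ hlen l' rfl
  have h3 : (word ((k : Multiset (Idx o)).sort) : Verma m₁ m₂) ∈
      Submodule.span ℂ (sortedWord o '' {M | degSum M = degSum ↑l}) :=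
    Submodule.subset_span ⟨_, rfl, rfl⟩
  simpa using Submodule.add_mem _ (h2 h1) h3

theorem toMonomial_sortedWord (o : Bool) (M : Multiset (Idx o)) :
    toMonomial m₁ m₂ o (sortedWord o M) = Finsupp.single M 1 := by
  rw [sortedWord, toMonomial_word o (Multiset.pairwise_sort _ _), Multiset.sort_eq]

variable (m₁ m₂) in
/-- The Poincaré–Birkhoff–Witt basis of the Verma module: the ordered monomials. -/
def pbw (o : Bool) : Module.Basis (Multiset (Idx o)) ℂ (Verma m₁ m₂) :=
  Module.Basis.mk (v := sortedWord o)
    (LinearIndependent.of_comp (toMonomial m₁ m₂ o) (by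
      convert (Finsupp.basisSingleOne (R := ℂ) (ι := Multiset (Idx o))).linearIndependent using 1
      ext1 M
      simp [toMonomial_sortedWord]))
    (by
      rw [← span_word, Submodule.span_le]
      rintro _ ⟨l, rfl⟩
      exact Submodule.span_mono (Set.image_subset_range _ _) (word_mem_span o l))

theorem pbw_apply (o : Bool) (M : Multiset (Idx o)) : pbw m₁ m₂ o M = sortedWord o M := by
  simp [pbw]

theorem pbw_zero (o : Bool) : pbw m₁ m₂ o 0 = hwv m₁ m₂ := by
  rw [pbw_apply, sortedWord, Multiset.sort_zero]; rfl

theorem pbw_mem_component (o : Bool) (M : Multiset (Idx o)) :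
    pbw m₁ m₂ o M ∈ component m₁ m₂ (degSum M) := by
  have h1 := word_mem_component (m₁ := m₁) (m₂ := m₂) M.sort
  rw [pbw_apply]
  have h2 : ((M.sort : List (Idx o)) : Multiset (Idx o)) = M := Multiset.sort_eq _ _
  exact (congrArg (fun N : Multiset NegIdx => sortedWord o M ∈ component m₁ m₂ (degSum N)) h2).mp h1

theorem component_le_span_pbw (o : Bool) (γ : ℕ × ℕ) :
    component m₁ m₂ γ ≤ Submodule.span ℂ (pbw m₁ m₂ o '' {M | degSum M = γ}) := by
  refine Submodule.span_le.mpr ?_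
  rintro _ ⟨l, h0, h1, rfl⟩
  obtain ⟨h2, h3⟩ := act_chevF (m₁ := m₁) (m₂ := m₂) l
  have h4 := word_mem_span (m₁ := m₁) (m₂ := m₂) o (l.map chevIdx)
  rw [h3, h0, h1] at h4
  rw [h2, show (pbw m₁ m₂ o : Multiset (Idx o) → _) = sortedWord o from funext (pbw_apply o)]
  exact h4

/-- The coordinate of a basis vector of degree `γ` vanishes on the other components. -/
theorem coord_eq_zero (o : Bool) {M : Multiset (Idx o)} {γ : ℕ × ℕ} (hγ : degSum M ≠ γ)
    {w : Verma m₁ m₂} (hw : w ∈ component m₁ m₂ γ) : (pbw m₁ m₂ o).coord M w = 0 := by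
  have h1 := component_le_span_pbw o γ hw
  rw [← LinearMap.mem_ker]
  refine (Submodule.span_le.mpr ?_ : _ ≤ LinearMap.ker ((pbw m₁ m₂ o).coord M)) h1
  rintro _ ⟨N, hN, rfl⟩
  rw [SetLike.mem_coe, LinearMap.mem_ker, Module.Basis.coord_apply, Module.Basis.repr_self,
    Finsupp.single_eq_of_ne]
  rintro rfl
  exact hγ hN

/-! ### The chosen bases and their dual covectors -/

theorem pbw_coe {o : Bool} {l : List (Idx o)} (hl : l.Pairwise (· ≤ ·)) :
    pbw m₁ m₂ o l = word l := by
  rw [pbw_apply, sortedWord_coe hl]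

/-- A sorted list of indices is a concatenation of three sorted lists, one for each generator
of `sl₂`. -/
theorem exists_eq_append {o : Bool} {c₀ c₁ c₂ : ℕ → Idx o}
    (hc : ∀ i, (∃ n, i = c₀ n) ∨ (∃ n, i = c₁ n) ∨ ∃ n, i = c₂ n)
    (h₁₀ : ∀ n k, ¬ orderKey o (c₁ n) ≤ orderKey o (c₀ k))
    (h₂₀ : ∀ n k, ¬ orderKey o (c₂ n) ≤ orderKey o (c₀ k))
    (h₂₁ : ∀ n k, ¬ orderKey o (c₂ n) ≤ orderKey o (c₁ k))
    {l : List (Idx o)} (hl : l.Pairwise (· ≤ ·)) :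
    ∃ A B C : List ℕ, l = A.map c₀ ++ B.map c₁ ++ C.map c₂ := by
  induction l with
  | nil => exact ⟨[], [], [], rfl⟩
  | cons i l ih =>
    rw [List.pairwise_cons] at hl
    obtain ⟨A, B, C, rfl⟩ := ih hl.2
    rcases hc i with ⟨n, rfl⟩ | ⟨n, rfl⟩ | ⟨n, rfl⟩
    · exact ⟨n :: A, B, C, rfl⟩
    · obtain rfl : A = [] := by
        rcases A with _ | ⟨k, A⟩
        · rfl
        · exact absurd (hl.1 (c₀ k) (by simp)) (h₁₀ n k)
      exact ⟨[], n :: B, C, rfl⟩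
    · obtain rfl : A = [] := by
        rcases A with _ | ⟨k, A⟩
        · rfl
        · exact absurd (hl.1 (c₀ k) (by simp)) (h₂₀ n k)
      obtain rfl : B = [] := by
        rcases B with _ | ⟨k, B⟩
        · rfl
        · exact absurd (hl.1 (c₁ k) (by simp)) (h₂₁ n k)
      exact ⟨[], [], n :: C, rfl⟩

/-- The word `f/T^{i₁} ⋯ h/T^{j₁+1} ⋯ e/T^{l₁+1} ⋯`, for `o = false`, or the one with the `f`- and
the `e`-factors exchanged, for `o = true`. -/
def blocks : (o : Bool) → List ℕ → List ℕ → List ℕ → List (Idx o)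
  | false, I, J, K => (I.map NegIdx.f ++ J.map NegIdx.h ++ K.map NegIdx.e : List NegIdx)
  | true, I, J, K => (K.map NegIdx.e ++ J.map NegIdx.h ++ I.map NegIdx.f : List NegIdx)

theorem pairwise_blocks {o : Bool} {I J K : List ℕ} :
    (blocks o I J K).Pairwise (· ≤ ·) ↔
      I.Pairwise (· ≥ ·) ∧ J.Pairwise (· ≥ ·) ∧ K.Pairwise (· ≥ ·) := by
  cases o
  · change List.Pairwise (fun i j => orderKey false i ≤ orderKey false j)
      (I.map NegIdx.f ++ J.map NegIdx.h ++ K.map NegIdx.e) ↔ _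
    rw [List.pairwise_append, List.pairwise_append, List.pairwise_map, List.pairwise_map,
      List.pairwise_map]
    simp [orderKey, Prod.Lex.toLex_le_toLex, or_imp, forall_and, and_assoc]
  · change List.Pairwise (fun i j => orderKey true i ≤ orderKey true j)
      (K.map NegIdx.e ++ J.map NegIdx.h ++ I.map NegIdx.f) ↔ _
    rw [List.pairwise_append, List.pairwise_append, List.pairwise_map, List.pairwise_map,
      List.pairwise_map]
    simp only [orderKey, Prod.Lex.toLex_le_toLex, List.mem_append, List.mem_map, or_imp,
      forall_and]
    simp
    tauto

theorem exists_eq_blocks {o : Bool} {l : List (Idx o)} (hl : l.Pairwise (· ≤ ·)) :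
    ∃ I J K : List ℕ, l = blocks o I J K := by
  cases o
  · refine exists_eq_append (c₀ := NegIdx.f) (c₁ := NegIdx.h) (c₂ := NegIdx.e) ?_ ?_ ?_ ?_ hl
    · rintro (n | n | n)
      exacts [.inl ⟨n, rfl⟩, .inr (.inl ⟨n, rfl⟩), .inr (.inr ⟨n, rfl⟩)]
    all_goals intro n k; simp [orderKey, Prod.Lex.toLex_le_toLex]
  · obtain ⟨K, J, I, h⟩ := exists_eq_append (c₀ := NegIdx.e) (c₁ := NegIdx.h) (c₂ := NegIdx.f)
      (o := true) (by
        rintro (n | n | n)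
        exacts [.inr (.inr ⟨n, rfl⟩), .inr (.inl ⟨n, rfl⟩), .inl ⟨n, rfl⟩])
      (by intro n k; simp [orderKey, Prod.Lex.toLex_le_toLex])
      (by intro n k; simp [orderKey, Prod.Lex.toLex_le_toLex])
      (by intro n k; simp [orderKey, Prod.Lex.toLex_le_toLex]) hl
    exact ⟨I, J, K, h⟩

theorem degSum_coe_append (l l' : List NegIdx) :
    degSum ↑(l ++ l') = degSum ↑l + degSum ↑l' := by
  simp [degSum]

theorem degSum_map_f (I : List ℕ) :
    degSum ↑(I.map NegIdx.f) = (I.sum + I.length, I.sum) := by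
  induction I with
  | nil => rfl
  | cons n I ih =>
    rw [List.map_cons, degSum_coe_cons, ih]
    simp only [negDeg, Prod.mk_add_mk, List.sum_cons, List.length_cons, Prod.mk.injEq, and_true]
    omega

theorem degSum_map_h (J : List ℕ) :
    degSum ↑(J.map NegIdx.h) = (J.sum + J.length, J.sum + J.length) := by
  induction J with
  | nil => rfl
  | cons n I ih =>
    rw [List.map_cons, degSum_coe_cons, ih]
    simp only [negDeg, Prod.mk_add_mk, List.sum_cons, List.length_cons, Prod.mk.injEq]
    omega

theorem degSum_map_e (K : List ℕ) :
    degSum ↑(K.map NegIdx.e) = (K.sum, K.sum + K.length) := by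
  induction K with
  | nil => rfl
  | cons n I ih =>
    rw [List.map_cons, degSum_coe_cons, ih]
    simp only [negDeg, Prod.mk_add_mk, List.sum_cons, List.length_cons, Prod.mk.injEq, true_and]
    omega

theorem degSum_blocks (o : Bool) (I J K : List ℕ) :
    degSum (blocks o I J K : Multiset (Idx o)) = (I.sum + I.length + (J.sum + J.length) + K.sum,
      I.sum + (J.sum + J.length) + (K.sum + K.length)) := by
  cases o
  · change degSum ↑(I.map NegIdx.f ++ J.map NegIdx.h ++ K.map NegIdx.e) = _
    simp only [degSum_coe_append, degSum_map_f, degSum_map_h, degSum_map_e, Prod.mk_add_mk]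
  · change degSum ↑(K.map NegIdx.e ++ J.map NegIdx.h ++ I.map NegIdx.f) = _
    simp only [degSum_coe_append, degSum_map_f, degSum_map_h, degSum_map_e, Prod.mk_add_mk,
      Prod.mk.injEq]
    omega

/-- The order used for the chosen basis of the component of degree `γ`. -/
def compOrder (γ : ℕ × ℕ) : Bool := decide (γ.1 < γ.2)

theorem word_blocks (γ : ℕ × ℕ) (I J K : List ℕ) :
    (word (blocks (compOrder γ) I J K) : Verma m₁ m₂) =
      if γ.1 < γ.2 then
        act ((K.map (· + 1)).map (divT e) ++ (J.map (· + 1)).map (divT h) ++ I.map (divT f))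
      else act (I.map (divT f) ++ (J.map (· + 1)).map (divT h) ++ (K.map (· + 1)).map (divT e)) := by
  by_cases hγ : γ.1 < γ.2
  · rw [if_pos hγ, show compOrder γ = true from decide_eq_true hγ]
    simp only [word, blocks, List.map_append, List.map_map]
    rfl
  · rw [if_neg hγ, show compOrder γ = false from decide_eq_false hγ]
    simp only [word, blocks, List.map_append, List.map_map]
    rfl

theorem exists_eq_map_succ {l : List ℕ} (hl : ∀ j ∈ l, 1 ≤ j) : ∃ k : List ℕ, l = k.map (· + 1) :=
  ⟨l.map (· - 1), by
    rw [List.map_map]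
    refine (List.map_id l).symm.trans (List.map_congr_left fun j hj => ?_)
    have := hl j hj
    simp only [id, Function.comp_apply]
    omega⟩

theorem sum_map_succ (l : List ℕ) : (l.map (· + 1)).sum = l.sum + l.length := by
  induction l with
  | nil => rfl
  | cons n l ih =>
    rw [List.map_cons, List.sum_cons, ih, List.sum_cons, List.length_cons]; omega

theorem pairwise_map_succ (l : List ℕ) :
    (l.map (· + 1)).Pairwise (· ≥ ·) ↔ l.Pairwise (· ≥ ·) := by
  rw [List.pairwise_map]; simp

/-- The chosen basis of a component is a part of one of the two Poincaré–Birkhoff–Witt bases. -/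
theorem chosenBasis_eq {γ : ℕ × ℕ} {o : Bool} (ho : compOrder γ = o) :
    chosenBasis m₁ m₂ γ = pbw m₁ m₂ o '' {M | degSum M = γ} := by
  subst ho
  ext w
  constructor
  · rintro ⟨I, J, K, hI, hJ, hK, hJ1, hK1, h1, h2, hw⟩
    obtain ⟨J, rfl⟩ := exists_eq_map_succ hJ1
    obtain ⟨K, rfl⟩ := exists_eq_map_succ hK1
    rw [← word_blocks] at hw
    rw [pairwise_map_succ] at hJ hK
    rw [sum_map_succ, sum_map_succ] at h1 h2
    rw [List.length_map] at h1
    refine ⟨(blocks (compOrder γ) I J K : List _), ?_, ?_⟩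
    · refine (degSum_blocks _ I J K).trans (Prod.ext ?_ ?_) <;> dsimp only <;> omega
    · rw [hw, pbw_coe (pairwise_blocks.mpr ⟨hI, hJ, hK⟩)]
  · rintro ⟨M, hM, rfl⟩
    obtain ⟨I, J, K, h⟩ := exists_eq_blocks (Multiset.pairwise_sort M (· ≤ ·))
    have hp : (blocks (compOrder γ) I J K).Pairwise (· ≤ ·) := h ▸ Multiset.pairwise_sort M (· ≤ ·)
    have hM' : M = (blocks (compOrder γ) I J K : List _) := by rw [← h, Multiset.sort_eq]
    subst hM'
    obtain ⟨hI, hJ, hK⟩ := pairwise_blocks.mp hp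
    have hdeg := (degSum_blocks (compOrder γ) I J K).symm.trans hM
    refine ⟨I, J.map (· + 1), K.map (· + 1), hI, (pairwise_map_succ J).mpr hJ,
      (pairwise_map_succ K).mpr hK, by simp, by simp, ?_, ?_, ?_⟩
    · rw [sum_map_succ, sum_map_succ, List.length_map, ← hdeg]; dsimp only; omega
    · rw [sum_map_succ, sum_map_succ, ← hdeg]
    · rw [pbw_coe hp, word_blocks]

/-- The coordinate functional of an ordered monomial, as a covector in `V*`. -/
def dualCoord (m₁ m₂ : ℂ) (o : Bool) (M : Multiset (Idx o)) : Contragredient m₁ m₂ :=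
  ⟨(pbw m₁ m₂ o).coord M, by
    refine (Set.finite_singleton (degSum M)).subset ?_
    rintro γ ⟨w, hw, hne⟩
    by_contra hγ
    exact hne (coord_eq_zero o (fun h => hγ h.symm) hw)⟩

theorem dualCoord_apply (o : Bool) (M : Multiset (Idx o)) (w : Verma m₁ m₂) :
    (dualCoord m₁ m₂ o M).1 w = (pbw m₁ m₂ o).coord M w := rfl

theorem coord_pbw (o : Bool) (M N : Multiset (Idx o)) [Decidable (N = M)] :
    (pbw m₁ m₂ o).coord M (pbw m₁ m₂ o N) = if N = M then 1 else 0 := by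
  rw [Module.Basis.coord_apply, Module.Basis.repr_self, Finsupp.single_apply]

theorem isDualTo_dualCoord {o : Bool} {M : Multiset (Idx o)} (ho : compOrder (degSum M) = o) :
    IsDualTo (pbw m₁ m₂ o M) (dualCoord m₁ m₂ o M) := by
  classical
  refine ⟨degSum M, ?_, ?_, ?_, fun γ hγ w hw => coord_eq_zero _ hγ.symm hw⟩
  · rw [chosenBasis_eq ho]; exact ⟨M, rfl, rfl⟩
  · rw [dualCoord_apply, coord_pbw, if_pos rfl]
  · intro w' hw' hne
    rw [chosenBasis_eq ho] at hw'
    obtain ⟨N, -, rfl⟩ := hw'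
    rw [dualCoord_apply, coord_pbw, if_neg]
    rintro rfl
    exact hne rfl

/-- A covector dual to a chosen basis vector is determined on the basis of all chosen vectors. -/
theorem IsDualTo.unique {w : Verma m₁ m₂} {φ ψ : Contragredient m₁ m₂} (hφ : IsDualTo w φ)
    (hψ : IsDualTo w ψ) : φ = ψ := by
  obtain ⟨γ, hw, h1, h2, h3⟩ := hφ
  obtain ⟨γ', hw', h1', h2', h3'⟩ := hψ
  have hmem {γ : ℕ × ℕ} {w : Verma m₁ m₂} (hw : w ∈ chosenBasis m₁ m₂ γ) :
      w ∈ component m₁ m₂ γ := by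
    rw [chosenBasis_eq rfl] at hw
    obtain ⟨M, hM, rfl⟩ := hw
    have h := pbw_mem_component (m₁ := m₁) (m₂ := m₂) (compOrder γ) M
    rwa [show degSum M = γ from hM] at h
  obtain rfl : γ' = γ := by
    by_contra hne
    exact one_ne_zero (h1.symm.trans (h3 _ hne _ (hmem hw')))
  apply Subtype.ext
  refine (pbw m₁ m₂ (compOrder γ')).ext fun M => ?_
  by_cases hM : degSum M = γ'
  · have hc : pbw m₁ m₂ (compOrder γ') M ∈ chosenBasis m₁ m₂ γ' := by
      rw [chosenBasis_eq rfl]; exact ⟨M, hM, rfl⟩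
    by_cases hw0 : pbw m₁ m₂ (compOrder γ') M = w
    · rw [hw0, h1, h1']
    · rw [h2 _ hc hw0, h2' _ hc hw0]
  · rw [h3 _ hM _ (pbw_mem_component _ M), h3' _ hM _ (pbw_mem_component _ M)]

theorem existsUnique_isDualTo {γ : ℕ × ℕ} {w : Verma m₁ m₂} (hw : w ∈ chosenBasis m₁ m₂ γ) :
    ∃! φ : Contragredient m₁ m₂, IsDualTo w φ := by
  rw [chosenBasis_eq rfl] at hw
  obtain ⟨M, hM, rfl⟩ := hw
  have hM' := isDualTo_dualCoord (m₁ := m₁) (m₂ := m₂) (congrArg compOrder hM)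
  exact ⟨_, hM', fun φ hφ => hφ.unique hM'⟩

theorem dualVec_eq {w : Verma m₁ m₂} {φ : Contragredient m₁ m₂} (h : IsDualTo w φ) :
    dualVec w = φ :=
  (Classical.epsilon_spec (p := IsDualTo w) ⟨φ, h⟩).unique h

theorem dualVec_pbw {o : Bool} {M : Multiset (Idx o)} (ho : compOrder (degSum M) = o) :
    dualVec (pbw m₁ m₂ o M) = dualCoord m₁ m₂ o M :=
  dualVec_eq (isDualTo_dualCoord ho)

/-- Both bases give the same covector dual to the generator. -/
theorem dualVec_hwv (o : Bool) : dualVec (hwv m₁ m₂) = dualCoord m₁ m₂ o 0 := by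
  classical
  have h0 : degSum (0 : Multiset (Idx o)) = 0 := degSum_eq_zero.mpr rfl
  refine dualVec_eq ⟨0, ?_, ?_, ?_, fun γ hγ w hw => coord_eq_zero _ (h0.trans_ne hγ.symm) hw⟩
  · rw [chosenBasis_eq rfl]; exact ⟨0, degSum_eq_zero.mpr rfl, pbw_zero _⟩
  · rw [← pbw_zero o, dualCoord_apply, coord_pbw, if_pos rfl]
  · intro w' hw' hne
    rw [chosenBasis_eq rfl] at hw'
    obtain ⟨N, hN, rfl⟩ := hw'
    obtain rfl : N = 0 := degSum_eq_zero.mp hN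
    exact absurd (pbw_zero _) hne

/-! ### The identity for operators -/

/-- The computation behind both identities. In the application `φ`, `ψ d`, `Q d` expand a vector in
monomials that start with the commuting operators `F (-n)`, `n ≥ 0`, and extract the constant term,
the coefficient of `F (-d)`, and the sum of the coefficients of the products `F (-i) F (-j)` with
`i + j = d`. Only the rules `hφF` to `hQF` are needed. -/
theorem functional_identity {V : Type*} [AddCommGroup V] [Module ℂ V] (E H F : ℤ → Module.End ℂ V)
    (μ k : ℂ)
    (hEF : ∀ i j w, E i (F j w) = F j (E i w) + H (i + j) w +
      (if i + j = 0 then (i : ℂ) * k else 0) • w)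
    (hHF : ∀ i j w, H i (F j w) = F j (H i w) - (2 : ℂ) • F (i + j) w)
    (hFF : ∀ i j w, F i (F j w) = F j (F i w))
    (φ : Module.Dual ℂ V) (ψ Q : ℕ → Module.Dual ℂ V)
    (hφF : ∀ (n : ℕ) w, φ (F (-n) w) = 0)
    (hφH : ∀ (n : ℕ) w, φ (H (-(n + 1 : ℕ)) w) = 0) (hφH0 : ∀ w, φ (H 0 w) = μ * φ w)
    (hψF : ∀ (d n : ℕ) w, ψ d (F (-n) w) = if d = n then φ w else 0)
    (hQF : ∀ (d n : ℕ) w, Q d (F (-n) w) = if n ≤ d then ψ (d - n) w else 0)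
    (N n : ℕ) (y : V) :
    φ (E N (F (-n) y)) = (μ + N * (k + 2)) * ψ N (F (-n) y) +
      ∑ l ∈ Finset.Icc 1 N, (ψ (N - l) (H l (F (-n) y)) + 2 * Q (N - l) (F l (F (-n) y))) := by
  have hterm (l : ℕ) : ψ (N - l) (H l (F (-n) y)) + 2 * Q (N - l) (F l (F (-n) y)) =
      (if N - l = n then φ (H l y) else 0) +
        2 * ((if n ≤ N - l then ψ (N - l - n) (F l y) else 0) - ψ (N - l) (F (l - n) y)) := by
    rw [hHF, hFF l, hQF, map_sub, hψF, map_smul, smul_eq_mul, ← sub_eq_add_neg]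
    ring
  rw [Finset.sum_congr rfl fun l _ => hterm l, Finset.sum_add_distrib, ← Finset.mul_sum,
    Finset.sum_sub_distrib, hψF, hEF, map_add, map_add, hφF, zero_add, map_smul, smul_eq_mul]
  -- For `l ≤ n` the operator `F (l - n)` is one of those that the functionals see.
  have hlow (l : ℕ) (hl : l ≤ n) : ψ (N - l) (F (l - n) y) = if N - l = n - l then φ y else 0 := by
    rw [← hψF, show -((n - l : ℕ) : ℤ) = l - n by omega]
  rcases lt_trichotomy N n with hN | rfl | hN
  · have hφ : φ (H (N + -n) y) = 0 := by
      rw [show (N : ℤ) + -n = -((n - N - 1 : ℕ) + 1 : ℕ) by omega, hφH]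
    rw [hφ, if_neg (by omega), if_neg (by omega)]
    have h1 : ∑ l ∈ Finset.Icc 1 N, (if N - l = n then φ (H l y) else 0) = 0 :=
      Finset.sum_eq_zero fun l hl => by
        rw [Finset.mem_Icc] at hl; rw [if_neg (by omega)]
    have h2 : ∑ l ∈ Finset.Icc 1 N, (if n ≤ N - l then ψ (N - l - n) (F l y) else 0) = 0 :=
      Finset.sum_eq_zero fun l hl => by
        rw [Finset.mem_Icc] at hl; rw [if_neg (by omega)]
    have h3 : ∑ l ∈ Finset.Icc 1 N, ψ (N - l) (F (l - n) y) = 0 :=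
      Finset.sum_eq_zero fun l hl => by
        rw [Finset.mem_Icc] at hl; rw [hlow l (by omega), if_neg (by omega)]
    rw [h1, h2, h3]; ring
  · rw [show (N : ℤ) + -N = 0 by omega, hφH0, if_pos rfl, if_pos rfl]
    have h1 : ∑ l ∈ Finset.Icc 1 N, (if N - l = N then φ (H l y) else 0) = 0 :=
      Finset.sum_eq_zero fun l hl => by
        rw [Finset.mem_Icc] at hl; rw [if_neg (by omega)]
    have h2 : ∑ l ∈ Finset.Icc 1 N, (if N ≤ N - l then ψ (N - l - N) (F l y) else 0) = 0 :=
      Finset.sum_eq_zero fun l hl => by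
        rw [Finset.mem_Icc] at hl; rw [if_neg (by omega)]
    have h3 : ∑ l ∈ Finset.Icc 1 N, ψ (N - l) (F (l - N) y) = N * φ y := by
      rw [Finset.sum_congr rfl fun l hl => (hlow l (Finset.mem_Icc.mp hl).2).trans (if_pos rfl)]
      simp
    rw [h1, h2, h3]; push_cast; ring
  · obtain ⟨D, rfl⟩ := Nat.exists_eq_add_of_lt hN
    have hφ : φ (H ((n + D + 1 : ℕ) + -n) y) = φ (H (D + 1 : ℕ) y) := by
      rw [show ((n + D + 1 : ℕ) : ℤ) + -n = (D + 1 : ℕ) by omega]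
    rw [hφ, if_neg (by omega), if_neg (by omega)]
    have h1 : ∑ l ∈ Finset.Icc 1 (n + D + 1), (if n + D + 1 - l = n then φ (H l y) else 0) =
        φ (H (D + 1 : ℕ) y) := by
      rw [Finset.sum_eq_single (D + 1)]
      · rw [if_pos (by omega)]
      · intro l hl hne
        rw [Finset.mem_Icc] at hl; rw [if_neg (by omega)]
      · intro hl
        exact absurd (Finset.mem_Icc.mpr ⟨by omega, by omega⟩) hl
    have h2 : ∑ l ∈ Finset.Icc 1 (n + D + 1),
        (if n ≤ n + D + 1 - l then ψ (n + D + 1 - l - n) (F l y) else 0) =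
        ∑ l ∈ Finset.Icc 1 (D + 1), ψ (D + 1 - l) (F l y) := by
      rw [← Finset.sum_filter]
      refine Finset.sum_congr ?_ fun l hl => ?_
      · ext l
        simp only [Finset.mem_filter, Finset.mem_Icc]
        omega
      · rw [show n + D + 1 - l - n = D + 1 - l by omega]
    have h3 : ∑ l ∈ Finset.Icc 1 (n + D + 1), ψ (n + D + 1 - l) (F (l - n) y) =
        ∑ l ∈ Finset.Icc 1 (D + 1), ψ (D + 1 - l) (F l y) := by
      symm
      refine Finset.sum_of_injOn (n + ·) (fun a _ b _ hab => by simpa using hab) ?_ ?_ ?_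
      · intro l hl
        simp only [Finset.coe_Icc, Set.mem_Icc] at hl ⊢
        omega
      · intro l hl hl'
        rw [Finset.mem_Icc] at hl
        have hln : l ≤ n := by
          by_contra hcon
          refine hl' ⟨l - n, ?_, ?_⟩
          · simp only [Finset.coe_Icc, Set.mem_Icc]; omega
          · dsimp only; omega
        rw [hlow l hln, if_neg (by omega)]
      · intro l hl
        rw [show n + D + 1 - (n + l) = D + 1 - l by omega]
        congr 3
        push_cast; ring
    rw [h1, h2, h3]; ring

/-! ### The leading generators of the two orders -/

/-- The index of `f/Tⁿ` for `o = false`, of `e/Tⁿ⁺¹` for `o = true`: the generators that stand on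
the left in the ordered monomials. -/
def first : (o : Bool) → ℕ → Idx o
  | false, n => NegIdx.f n
  | true, n => NegIdx.e n

theorem lie_first (o : Bool) (i j : ℕ) :
    ⁅negGen (first o i), negGen (first o j)⁆ = 0 := by
  cases o
  · exact lie_loop_f_f _ _
  · exact lie_loop_e_e _ _

theorem exists_eq_first {o : Bool} {n : ℕ} {i : Idx o} (hi : i < first o n) :
    ∃ k, i = first o k := by
  rw [← not_le] at hi
  cases o <;> rcases i with k | k | k
  · exact ⟨k, rfl⟩
  · exact absurd (Idx.le_iff.mpr (by simp [first, orderKey, Prod.Lex.toLex_le_toLex])) hi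
  · exact absurd (Idx.le_iff.mpr (by simp [first, orderKey, Prod.Lex.toLex_le_toLex])) hi
  · exact absurd (Idx.le_iff.mpr (by simp [first, orderKey, Prod.Lex.toLex_le_toLex])) hi
  · exact absurd (Idx.le_iff.mpr (by simp [first, orderKey, Prod.Lex.toLex_le_toLex])) hi
  · exact ⟨k, rfl⟩

theorem lie_pbw_of_le {o : Bool} {i : Idx o} {M : Multiset (Idx o)} (hi : ∀ j ∈ M, i ≤ j) :
    ⁅negGen i, pbw m₁ m₂ o M⁆ = pbw m₁ m₂ o (i ::ₘ M) := by
  rw [pbw_apply, pbw_apply]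
  have h : (i ::ₘ M).sort = i :: M.sort := Multiset.sort_cons _ _ _ hi
  exact (congrArg (fun l : List (Idx o) => (word l : Verma m₁ m₂)) h).symm

/-- The leading generators act on ordered monomials by multiplication, since they commute. -/
theorem lie_first_pbw (o : Bool) (n : ℕ) (M : Multiset (Idx o)) :
    ⁅negGen (first o n), pbw m₁ m₂ o M⁆ = pbw m₁ m₂ o (first o n ::ₘ M) := by
  have key (l : List (Idx o)) (hl : l.Pairwise (· ≤ ·)) :
      ⁅negGen (first o n), pbw m₁ m₂ o l⁆ = pbw m₁ m₂ o (first o n ::ₘ l) := by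
    induction l with
    | nil => exact lie_pbw_of_le (by simp)
    | cons i l ih =>
      rw [List.pairwise_cons] at hl
      rcases le_or_gt (first o n) i with hi | hi
      · refine lie_pbw_of_le fun j hj => ?_
        rcases List.mem_cons.mp hj with rfl | hj
        · exact hi
        · exact hi.trans (hl.1 j hj)
      · obtain ⟨k, rfl⟩ := exists_eq_first hi
        rw [← Multiset.cons_coe, ← lie_pbw_of_le (by simpa using hl.1), leibniz_lie, lie_first,
          zero_lie, zero_add, ih hl.2, lie_pbw_of_le, Multiset.cons_swap]
        intro j hj
        rcases Multiset.mem_cons.mp hj with rfl | hj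
        · exact hi.le
        · exact hl.1 j hj
  have := key M.sort (Multiset.pairwise_sort _ _)
  rwa [Multiset.sort_eq] at this

/-- The elements that play the role of `e Tʲ`: for `o = true` they are the images under the
automorphism that exchanges the two Chevalley generators of each kind. -/
def genE : Bool → ℤ → AffSl2
  | false, j => loop j e
  | true, j => loop (j + 1) f

/-- The elements that play the role of `h Tʲ`. -/
def genH : Bool → ℤ → AffSl2
  | false, j => loop j h
  | true, j => -loop j h + if j = 0 then c else 0

/-- The elements that play the role of `f Tʲ`. -/
def genF : Bool → ℤ → AffSl2
  | false, j => loop j f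
  | true, j => loop (j - 1) e

theorem lie_genE_genF (o : Bool) (i j : ℤ) :
    ⁅genE o i, genF o j⁆ = genH o (i + j) + (if i + j = 0 then (i : ℂ) else 0) • c := by
  cases o
  · exact lie_loop_e_f i j
  · simp only [genE, genF, genH]
    rw [lie_loop_f_e, show i + 1 + (j - 1) = i + j by ring, add_assoc]
    split_ifs
    · push_cast; rw [add_smul, one_smul, add_comm c]
    · simp

theorem lie_genH_genF (o : Bool) (i j : ℤ) :
    ⁅genH o i, genF o j⁆ = (-2 : ℂ) • genF o (i + j) := by
  cases o
  · exact lie_loop_h_f i j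
  · simp only [genF, genH]
    have hc : ⁅(if i = 0 then c else 0), loop (j - 1) e⁆ = 0 := by
      split_ifs
      · exact c_lie _
      · simp
    rw [add_lie, neg_lie, hc, lie_loop_h_e, add_zero, neg_smul, add_sub_assoc]

theorem lie_genF_genF (o : Bool) (i j : ℤ) : ⁅genF o i, genF o j⁆ = 0 := by
  cases o
  · exact lie_loop_f_f i j
  · exact lie_loop_e_e _ _

theorem lie_genH_genE (o : Bool) (j : ℤ) : ⁅genH o 0, genE o j⁆ = (2 : ℂ) • genE o j := by
  cases o
  · simpa [genH, genE] using lie_loop_h_e 0 j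
  · simp only [genE, genH]
    rw [if_true, add_lie, neg_lie, c_lie, lie_loop_h_f]
    simp

theorem lie_genH_genH (o : Bool) (j : ℤ) : ⁅genH o 0, genH o j⁆ = 0 := by
  have h1 := lie_loop_h_h 0 j (fun _ => rfl)
  cases o
  · exact h1
  · simp only [genH]
    split_ifs <;> simp [h1, lie_c, c_lie]

theorem genF_neg (o : Bool) (n : ℕ) : genF o (-n) = negGen (first o n) := by
  cases o
  · rfl
  · simp only [genF, first, negGen, divT]
    congr 2; omega

theorem genH_neg (o : Bool) (n : ℕ) :
    ∃ r : ℂ, genH o (-(n + 1 : ℕ)) = r • negGen (.h n) := by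
  cases o
  · exact ⟨1, (one_smul _ _).symm⟩
  · refine ⟨-1, ?_⟩
    simp only [genH, negGen, divT]
    rw [if_neg (by omega), add_zero, neg_smul, one_smul]

/-! ### Weights -/

/-- The eigenvalue of `genH o 0` on the generator of `V(m₁, m₂)`. -/
def topWeight (m₁ m₂ : ℂ) : Bool → ℂ
  | false => m₁
  | true => m₂

/-- The weight of a negative basis vector under `genH o 0`. -/
def negWeight : Bool → NegIdx → ℤ
  | false, .f _ => -2
  | false, .h _ => 0
  | false, .e _ => 2
  | true, .f _ => 2
  | true, .h _ => 0
  | true, .e _ => -2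

theorem lie_genH_negGen (o : Bool) (i : NegIdx) :
    ⁅genH o 0, negGen i⁆ = (negWeight o i : ℂ) • negGen i := by
  cases o <;> rcases i with n | n | n <;>
    simp [genH, negGen, divT, negWeight, lie_loop_h_e, lie_loop_h_f, c_lie,
      lie_loop_h_h 0 _ (fun _ => rfl), -neg_add_rev]

theorem genH_hwv (o : Bool) : ⁅genH o 0, hwv m₁ m₂⁆ = topWeight m₁ m₂ o • hwv m₁ m₂ := by
  cases o
  · exact loop_zero_h_hwv
  · simp only [genH, topWeight]
    rw [if_true, add_lie, neg_lie, c_hwv, loop_zero_h_hwv, add_smul]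
    abel

/-- The weight of an ordered monomial, relative to that of the generator. -/
def weightSum (o : Bool) (M : Multiset NegIdx) : ℤ := (M.map (negWeight o)).sum

theorem genH_word (o : Bool) (l : List NegIdx) : ⁅genH o 0, (word l : Verma m₁ m₂)⁆ =
    (topWeight m₁ m₂ o + weightSum o ↑l) • word l := by
  induction l with
  | nil => rw [word_nil, genH_hwv]; simp [weightSum]
  | cons i l ih =>
    rw [word_cons, leibniz_lie, lie_genH_negGen, ih, smul_lie, lie_smul, ← add_smul]
    congr 1
    simp only [weightSum, Multiset.map_coe, List.map_cons, Multiset.sum_coe, List.sum_cons]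
    push_cast; ring

theorem genH_pbw (o : Bool) (M : Multiset (Idx o)) : ⁅genH o 0, pbw m₁ m₂ o M⁆ =
    (topWeight m₁ m₂ o + weightSum o M) • pbw m₁ m₂ o M := by
  have hM : ((M.sort : List (Idx o)) : Multiset (Idx o)) = M := Multiset.sort_eq _ _
  rw [pbw_apply, sortedWord]
  refine (genH_word o M.sort).trans ?_
  exact congrArg (fun N : Multiset NegIdx => (topWeight m₁ m₂ o + (weightSum o N : ℂ)) •
    (word M.sort : Verma m₁ m₂)) hM

theorem coord_genH (o : Bool) (M : Multiset (Idx o)) (w : Verma m₁ m₂) :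
    (pbw m₁ m₂ o).coord M ⁅genH o 0, w⁆ =
      (topWeight m₁ m₂ o + weightSum o M) * (pbw m₁ m₂ o).coord M w := by
  classical
  suffices h : (pbw m₁ m₂ o).coord M ∘ₗ LieModule.toEnd ℂ AffSl2 (Verma m₁ m₂) (genH o 0) =
      (topWeight m₁ m₂ o + (weightSum o M : ℂ)) • (pbw m₁ m₂ o).coord M from
    LinearMap.congr_fun h w
  refine (pbw m₁ m₂ o).ext fun N => ?_
  rw [LinearMap.comp_apply, LieModule.toEnd_apply_apply, genH_pbw, map_smul, LinearMap.smul_apply,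
    coord_pbw]
  split_ifs with hN
  · rw [hN]
  · simp

theorem coord_eq_zero_of_weight {o : Bool} {M : Multiset (Idx o)} {w : Verma m₁ m₂} {r : ℂ}
    (hw : ⁅genH o 0, w⁆ = (topWeight m₁ m₂ o + r) • w) (hr : r ≠ weightSum o M) :
    (pbw m₁ m₂ o).coord M w = 0 := by
  have h1 := coord_genH o M w
  rw [hw, map_smul, smul_eq_mul, mul_eq_mul_right_iff, add_right_inj] at h1
  exact h1.resolve_left hr

/-- An ordered monomial either starts with a leading generator, or has a nonnegative weight. -/
theorem first_or_weight (o : Bool) (M : Multiset (Idx o)) :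
    (∃ n N, M = first o n ::ₘ N) ∨ 0 ≤ weightSum o M := by
  by_cases h : ∃ n, first o n ∈ M
  · obtain ⟨n, hn⟩ := h
    exact .inl ⟨n, Multiset.exists_cons_of_mem hn⟩
  · refine .inr (Multiset.sum_nonneg fun x hx => ?_)
    obtain ⟨i, hi, rfl⟩ := Multiset.mem_map.mp hx
    push Not at h
    cases o <;> rcases i with n | n | n
    · exact absurd hi (h n)
    · exact le_rfl
    · exact Int.le_of_lt (by decide : (0 : ℤ) < 2)
    · exact Int.le_of_lt (by decide : (0 : ℤ) < 2)
    · exact le_rfl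
    · exact absurd hi (h n)

/-! ### The identity for coordinate functionals -/

/-- The sum of the coordinates of the quadratic monomials in the leading generators whose indices
add up to `d`. -/
def quadCoord (m₁ m₂ : ℂ) (o : Bool) (d : ℕ) : Module.Dual ℂ (Verma m₁ m₂) :=
  ∑ p ∈ Finset.HasAntidiagonal.antidiagonal d with p.2 ≤ p.1,
    (pbw m₁ m₂ o).coord {first o p.1, first o p.2}

theorem first_injective (o : Bool) : Function.Injective (first o) := by
  intro i j hij
  cases o
  · exact NegIdx.f.inj hij
  · exact NegIdx.e.inj hij

theorem lie_first_eq {o : Bool} {n : ℕ} {θ θ' : Module.Dual ℂ (Verma m₁ m₂)}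
    (h : ∀ M, θ (pbw m₁ m₂ o (first o n ::ₘ M)) = θ' (pbw m₁ m₂ o M)) (w : Verma m₁ m₂) :
    θ ⁅negGen (first o n), w⁆ = θ' w := by
  suffices h : θ ∘ₗ LieModule.toEnd ℂ AffSl2 (Verma m₁ m₂) (negGen (first o n)) = θ' from
    LinearMap.congr_fun h w
  refine (pbw m₁ m₂ o).ext fun M => ?_
  rw [LinearMap.comp_apply, LieModule.toEnd_apply_apply, lie_first_pbw, h]

theorem coord_zero_negGen (o : Bool) (i : NegIdx) (w : Verma m₁ m₂) :
    (pbw m₁ m₂ o).coord 0 ⁅negGen i, w⁆ = 0 := by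
  suffices h : (pbw m₁ m₂ o).coord 0 ∘ₗ LieModule.toEnd ℂ AffSl2 (Verma m₁ m₂) (negGen i) = 0 from
    LinearMap.congr_fun h w
  refine (pbw m₁ m₂ o).ext fun M => ?_
  refine coord_eq_zero o (γ := negDeg i + degSum M) ?_
    (shifts_negGen i _ _ (pbw_mem_component o M))
  rw [show degSum (0 : Multiset (Idx o)) = 0 from rfl]
  intro h0
  exact negDeg_ne_zero i (add_eq_zero.mp h0.symm).1

theorem cons_eq_singleton {α : Type*} {a b : α} {s : Multiset α} :
    a ::ₘ s = {b} ↔ a = b ∧ s = 0 := by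
  rw [eq_comm, Multiset.singleton_eq_cons_iff, eq_comm, eq_comm (a := s)]

theorem coord_single_first (o : Bool) (d n : ℕ) (w : Verma m₁ m₂) :
    (pbw m₁ m₂ o).coord {first o d} ⁅negGen (first o n), w⁆ =
      if d = n then (pbw m₁ m₂ o).coord 0 w else 0 := by
  classical
  have h1 := lie_first_eq (o := o) (n := n) (θ := (pbw m₁ m₂ o).coord {first o d})
    (θ' := if d = n then (pbw m₁ m₂ o).coord 0 else 0) (fun M => ?_) w
  · rw [h1]; split_ifs <;> rfl
  · have h2 : first o n ::ₘ M = {first o d} ↔ d = n ∧ M = 0 := by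
      rw [cons_eq_singleton, (first_injective o).eq_iff, eq_comm (a := n)]
    rw [coord_pbw]
    by_cases hd : d = n
    · rw [if_pos hd, coord_pbw]
      simp only [h2, eq_true hd, true_and]
    · rw [if_neg hd, if_neg fun h => hd (h2.mp h).1]
      rfl

theorem quadCoord_first (o : Bool) (d n : ℕ) (w : Verma m₁ m₂) :
    quadCoord m₁ m₂ o d ⁅negGen (first o n), w⁆ =
      if n ≤ d then (pbw m₁ m₂ o).coord {first o (d - n)} w else 0 := by
  classical
  have h1 := lie_first_eq (o := o) (n := n) (θ := quadCoord m₁ m₂ o d)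
    (θ' := if n ≤ d then (pbw m₁ m₂ o).coord {first o (d - n)} else 0) (fun M => ?_) w
  · rw [h1]; split_ifs <;> rfl
  rw [quadCoord, LinearMap.sum_apply]
  simp only [coord_pbw]
  -- A product `first n * M` is one of the monomials of `quadCoord` iff `M` is `first (d - n)`.
  have hpair (p : ℕ × ℕ) (hp : p.1 + p.2 = d)
      (h : first o n ::ₘ M = {first o p.1, first o p.2}) : n ≤ d ∧ M = {first o (d - n)} := by
    rw [Multiset.insert_eq_cons, Multiset.cons_eq_cons] at h
    rcases h with ⟨h, rfl⟩ | ⟨-, N, rfl, h⟩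
    · have := first_injective o h
      exact ⟨by omega, by rw [show d - n = p.2 by omega]⟩
    · obtain ⟨h', rfl⟩ := cons_eq_singleton.mp h.symm
      have := first_injective o h'
      exact ⟨by omega, by rw [show d - n = p.1 by omega]; rfl⟩
  by_cases hM : n ≤ d ∧ M = {first o (d - n)}
  · obtain ⟨hn, rfl⟩ := hM
    rw [if_pos hn, coord_pbw, if_pos rfl,
      Finset.sum_eq_single (max n (d - n), min n (d - n))]
    · rw [if_pos]
      rcases le_total n (d - n) with h | h
      · rw [max_eq_right h, min_eq_left h]; exact Multiset.cons_swap _ _ _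
      · rw [max_eq_left h, min_eq_right h]; rfl
    · rintro ⟨i, j⟩ hp hne
      rw [Finset.mem_filter, Finset.HasAntidiagonal.mem_antidiagonal] at hp
      dsimp only at hp ⊢
      rw [if_neg]
      intro h
      have hi : first o n = first o i ∨ first o n = first o j := by
        have : first o n ∈ ({first o i, first o j} : Multiset (Idx o)) :=
          h ▸ Multiset.mem_cons_self _ _
        simpa using this
      apply hne
      rw [(first_injective o).eq_iff, (first_injective o).eq_iff] at hi
      rw [Prod.mk.injEq]
      omega
    · intro h
      refine absurd ?_ h
      rw [Finset.mem_filter, Finset.HasAntidiagonal.mem_antidiagonal]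
      dsimp only
      omega
  · rw [Finset.sum_eq_zero fun p hp => ?_]
    · split_ifs with hn
      · rw [coord_pbw, if_neg fun h => hM ⟨hn, h⟩]
      · rfl
    · rw [Finset.mem_filter, Finset.HasAntidiagonal.mem_antidiagonal] at hp
      rw [if_neg fun h => hM (hpair p hp.1 h)]

theorem coord_identity (m₁ m₂ : ℂ) (o : Bool) (N : ℕ) (w : Verma m₁ m₂) :
    (pbw m₁ m₂ o).coord 0 ⁅genE o N, w⁆ =
      (topWeight m₁ m₂ o + N * (m₁ + m₂ + 2)) * (pbw m₁ m₂ o).coord {first o N} w +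
      ∑ l ∈ Finset.Icc 1 N, ((pbw m₁ m₂ o).coord {first o (N - l)} ⁅genH o l, w⁆ +
        2 * quadCoord m₁ m₂ o (N - l) ⁅genF o l, w⁆) := by
  set T := LieModule.toEnd ℂ AffSl2 (Verma m₁ m₂)
  suffices h : (pbw m₁ m₂ o).coord 0 ∘ₗ T (genE o N) =
      (topWeight m₁ m₂ o + N * (m₁ + m₂ + 2)) • (pbw m₁ m₂ o).coord {first o N} +
      ∑ l ∈ Finset.Icc 1 N, ((pbw m₁ m₂ o).coord {first o (N - l)} ∘ₗ T (genH o l) +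
        (2 : ℂ) • quadCoord m₁ m₂ o (N - l) ∘ₗ T (genF o l)) by
    have := LinearMap.congr_fun h w
    simpa [T, LinearMap.sum_apply] using this
  refine (pbw m₁ m₂ o).ext fun M => ?_
  simp only [LinearMap.comp_apply, LinearMap.add_apply, LinearMap.smul_apply, LinearMap.sum_apply,
    smul_eq_mul]
  rcases first_or_weight o M with ⟨n, M, rfl⟩ | hM
  · rw [← lie_first_pbw, ← genF_neg]
    refine functional_identity (T ∘ genE o) (T ∘ genH o) (T ∘ genF o) _ _ ?_ ?_ ?_ _
      (fun d => (pbw m₁ m₂ o).coord {first o d}) (quadCoord m₁ m₂ o) ?_ ?_ ?_ ?_ ?_ N n _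
    · intro i j w
      change ⁅genE o i, ⁅genF o j, w⁆⁆ = ⁅genF o j, ⁅genE o i, w⁆⁆ + ⁅genH o (i + j), w⁆ + _
      rw [leibniz_lie, lie_genE_genF, add_lie, smul_lie, c_lie_verma, smul_smul, ite_mul, zero_mul]
      abel
    · intro i j w
      change ⁅genH o i, ⁅genF o j, w⁆⁆ = ⁅genF o j, ⁅genH o i, w⁆⁆ - (2 : ℂ) • ⁅genF o (i + j), w⁆
      rw [leibniz_lie, lie_genH_genF, smul_lie, neg_smul]
      abel
    · intro i j w
      change ⁅genF o i, ⁅genF o j, w⁆⁆ = ⁅genF o j, ⁅genF o i, w⁆⁆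
      rw [leibniz_lie, lie_genF_genF, zero_lie, zero_add]
    · intro n w
      rw [Function.comp_apply, genF_neg]
      exact coord_zero_negGen o _ w
    · intro n w
      obtain ⟨r, hr⟩ := genH_neg o n
      rw [Function.comp_apply, hr, map_smul, LinearMap.smul_apply, map_smul]
      exact (congrArg (r • ·) (coord_zero_negGen o _ w)).trans (smul_zero r)
    · intro w
      refine (coord_genH o 0 w).trans ?_
      rw [show weightSum o (0 : Multiset (Idx o)) = 0 from rfl, Int.cast_zero, add_zero]
    · intro d n w
      rw [Function.comp_apply, genF_neg]
      exact coord_single_first o d n w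
    · intro d n w
      rw [Function.comp_apply, genF_neg]
      exact quadCoord_first o d n w
  · -- Here the two sides vanish for reasons of weight.
    have hw := genH_pbw (m₁ := m₁) (m₂ := m₂) o M
    set w := pbw m₁ m₂ o M
    have hshift (x : AffSl2) (r : ℂ) (hx : ⁅genH o 0, x⁆ = r • x) :
        ⁅genH o 0, T x w⁆ = (topWeight m₁ m₂ o + (r + weightSum o M)) • T x w := by
      change ⁅genH o 0, ⁅x, w⁆⁆ = (topWeight m₁ m₂ o + (r + weightSum o M)) • ⁅x, w⁆
      rw [leibniz_lie, hx, hw, smul_lie, lie_smul, ← add_smul]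
      congr 1; ring
    have hfirst (d : ℕ) : negWeight o (first o d) = -2 := by cases o <;> rfl
    have hψ (d : ℕ) : weightSum o ({first o d} : Multiset (Idx o)) = -2 :=
      (add_zero _).trans (hfirst d)
    have hQ (i j : ℕ) : weightSum o ({first o i, first o j} : Multiset (Idx o)) = -4 := by
      change negWeight o (first o i) + (negWeight o (first o j) + 0) = -4
      rw [hfirst, hfirst]; norm_num
    have hne (a b : ℤ) (hab : a + weightSum o M ≠ b) : (a : ℂ) + weightSum o M ≠ b := by
      exact_mod_cast hab
    have e0 : weightSum o (0 : Multiset (Idx o)) = 0 := rfl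
    have t1 : (pbw m₁ m₂ o).coord 0 (T (genE o N) w) = 0 := by
      refine coord_eq_zero_of_weight (hshift _ 2 (lie_genH_genE o N)) ?_
      rw [e0]; exact hne 2 0 (by omega)
    have t2 : (pbw m₁ m₂ o).coord {first o N} w = 0 := by
      refine coord_eq_zero_of_weight hw ?_
      rw [hψ, Ne, Int.cast_inj]; omega
    rw [t1, t2, mul_zero, zero_add, Finset.sum_eq_zero]
    intro l _
    have t3 : (pbw m₁ m₂ o).coord {first o (N - l)} (T (genH o l) w) = 0 := by
      refine coord_eq_zero_of_weight (hshift _ 0 (by rw [lie_genH_genH, zero_smul])) ?_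
      rw [hψ, zero_add, Ne, Int.cast_inj]; omega
    have t4 : quadCoord m₁ m₂ o (N - l) (T (genF o l) w) = 0 := by
      rw [quadCoord, LinearMap.sum_apply]
      refine Finset.sum_eq_zero fun p _ => ?_
      refine coord_eq_zero_of_weight
        (hshift _ (-2) (by rw [lie_genH_genF, zero_add])) ?_
      rw [hQ]
      have := hne (-2) (-4) (by omega)
      exact_mod_cast this
    rw [t3, t4]; ring

/-! ### The identity in the contragredient module -/

theorem transpose_h : transpose h = h := by
  apply Subtype.ext
  ext i j
  fin_cases i <;> fin_cases j <;> simp [transpose, h]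

theorem chev_divT (x : Sl2) (n : ℕ) : chev (divT x n) = loop n (transpose x) := by
  rw [divT, chev_loop, neg_neg]

theorem chev_first (o : Bool) (n : ℕ) : chev (negGen (first o n)) = genE o n := by
  cases o
  · exact (chev_divT f n).trans (by rw [transpose_f]; rfl)
  · exact (chev_divT e (n + 1)).trans (by rw [transpose_e]; simp [genE])

theorem dualVec_first (o : Bool) (n : ℕ) :
    dualVec ⁅negGen (first o n), hwv m₁ m₂⁆ = dualCoord m₁ m₂ o {first o n} := by
  rw [← pbw_zero o, lie_first_pbw, Multiset.cons_zero]
  refine dualVec_pbw ?_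
  cases o
  · exact decide_eq_false (by change ¬ n + 1 + 0 < n + 0; omega)
  · exact decide_eq_true (by change n + 0 < n + 1 + 0; omega)

theorem dualVec_first_first (o : Bool) (i j : ℕ) :
    dualVec ⁅negGen (first o i), ⁅negGen (first o j), hwv m₁ m₂⁆⁆ =
      dualCoord m₁ m₂ o {first o i, first o j} := by
  rw [← pbw_zero o, lie_first_pbw, lie_first_pbw]
  refine dualVec_pbw ?_
  cases o
  · exact decide_eq_false (by change ¬ i + 1 + (j + 1 + 0) < i + (j + 0); omega)
  · exact decide_eq_true (by change i + (j + 0) < i + 1 + (j + 1 + 0); omega)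

/-- Both identities of the theorem at once, in terms of the generators attached to the order `o`. -/
theorem dualVec_identity (m₁ m₂ : ℂ) (o : Bool) (N : ℕ) (x y : ℕ → AffSl2)
    (hx : ∀ l, 1 ≤ l → chev (x l) = genH o l) (hy : ∀ l, 1 ≤ l → chev (y l) = genF o l) :
    ⁅negGen (first o N), dualVec (hwv m₁ m₂)⁆ =
      (topWeight m₁ m₂ o + N * (m₁ + m₂ + 2)) • dualVec ⁅negGen (first o N), hwv m₁ m₂⁆ +
      ∑ l ∈ Finset.Icc 1 N, (⁅x l, dualVec ⁅negGen (first o (N - l)), hwv m₁ m₂⁆⁆ +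
        (2 : ℂ) • ⁅y l, ∑ p ∈ Finset.HasAntidiagonal.antidiagonal (N - l) with p.2 ≤ p.1,
          dualVec ⁅negGen (first o p.1), ⁅negGen (first o p.2), hwv m₁ m₂⁆⁆⁆) := by
  simp only [dualVec_first, dualVec_first_first, dualVec_hwv o]
  apply Subtype.ext
  ext w
  have hQ (d : ℕ) : (∑ p ∈ Finset.HasAntidiagonal.antidiagonal d with p.2 ≤ p.1,
      dualCoord m₁ m₂ o {first o p.1, first o p.2}).1 = quadCoord m₁ m₂ o d := by
    rw [quadCoord, Submodule.coe_sum]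
    rfl
  rw [lie_contragredient_apply, chev_first, dualCoord_apply, coord_identity, Submodule.coe_add,
    Submodule.coe_sum, LinearMap.add_apply, LinearMap.sum_apply]
  refine congrArg₂ (· + ·) rfl (Finset.sum_congr rfl fun l hl => ?_)
  rw [Finset.mem_Icc] at hl
  rw [← hx l hl.1, ← hy l hl.1, ← hQ]
  rfl

end AffineSl2

end

theorem theorem3p2 (m k : ℂ) (a : ℕ) (ha : 0 < a) :
    (∀ (γ : ℕ × ℕ) (w : Verma m (k - m)), w ∈ chosenBasis m (k - m) γ →
      ∃! φ : Contragredient m (k - m), IsDualTo w φ) ∧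
    (⁅divT f (a - 1), dualVec (hwv m (k - m))⁆ =
      (m + ((a : ℂ) - 1) * (k + 2)) • dualVec ⁅divT f (a - 1), hwv m (k - m)⁆ +
      ∑ l ∈ Finset.Icc 1 (a - 1),
        (⁅divT h l, dualVec ⁅divT f (a - 1 - l), hwv m (k - m)⁆⁆ +
          (2 : ℂ) • ⁅divT e l,
            ∑ p ∈ Finset.HasAntidiagonal.antidiagonal (a - 1 - l) with p.2 ≤ p.1,
              dualVec ⁅divT f p.1, ⁅divT f p.2, hwv m (k - m)⁆⁆⁆)) ∧
    (⁅divT e a, dualVec (hwv m (k - m))⁆ =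
      ((a : ℂ) * (k + 2) - m - 2) • dualVec ⁅divT e a, hwv m (k - m)⁆ +
      ∑ l ∈ Finset.range (a - 1),
        (-⁅divT h (l + 1), dualVec ⁅divT e (a - l - 1), hwv m (k - m)⁆⁆ +
          (2 : ℂ) • ⁅divT f l,
            ∑ p ∈ Finset.HasAntidiagonal.antidiagonal (a - l) with 1 ≤ p.2 ∧ p.2 ≤ p.1,
              dualVec ⁅divT e p.1, ⁅divT e p.2, hwv m (k - m)⁆⁆⁆)) := by
  obtain ⟨N, rfl⟩ := Nat.exists_eq_add_of_lt ha
  rw [zero_add, Nat.add_sub_cancel]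
  refine ⟨fun γ w hw => existsUnique_isDualTo hw, ?_, ?_⟩
  · have h1 := dualVec_identity m (k - m) false N (divT h) (divT e)
      (fun l _ => by rw [chev_divT, transpose_h]; rfl)
      (fun l _ => by rw [chev_divT, transpose_e]; rfl)
    have hc : m + (((N + 1 : ℕ) : ℂ) - 1) * (k + 2) =
        topWeight m (k - m) false + N * (m + (k - m) + 2) := by
      simp only [topWeight]; push_cast; ring
    rw [hc]
    exact h1
  · have h1 := dualVec_identity m (k - m) true N (fun l => -divT h l) (fun l => divT f (l - 1))
      (fun l hl => by
        rw [map_neg, chev_divT, transpose_h]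
        simp only [genH]
        rw [if_neg (by omega), add_zero])
      (fun l hl => by
        rw [chev_divT, transpose_f]
        simp only [genF]
        congr 2; omega)
    have hc : ((N + 1 : ℕ) : ℂ) * (k + 2) - m - 2 =
        topWeight m (k - m) true + N * (m + (k - m) + 2) := by
      simp only [topWeight]; push_cast; ring
    rw [hc]
    refine h1.trans (congrArg₂ (· + ·) rfl ?_)
    rw [Finset.range_eq_Ico, ← Finset.Ico_add_one_right_eq_Icc, ← Finset.sum_Ico_add' _ 0 N 1]
    refine Finset.sum_congr rfl fun l hl => ?_
    rw [Finset.mem_Ico] at hl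
    obtain ⟨d, rfl⟩ := Nat.exists_eq_add_of_lt hl.2
    rw [neg_lie, show l + d + 1 - (l + 1) = d by omega, show l + d + 1 + 1 - l - 1 = d + 1 by omega,
      show l + d + 1 + 1 - l = d + 2 by omega, Nat.add_sub_cancel]
    refine congrArg₂ (· + ·) rfl (congrArg (fun φ => (2 : ℂ) • ⁅divT f l, φ⁆) ?_)
    refine Finset.sum_nbij' (fun p => (p.1 + 1, p.2 + 1)) (fun p => (p.1 - 1, p.2 - 1))
      ?_ ?_ ?_ ?_ fun p _ => rfl
    all_goals
      rintro ⟨i, j⟩ hp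
      simp only [Finset.mem_filter, Finset.HasAntidiagonal.mem_antidiagonal, Prod.mk.injEq]
        at hp ⊢
      omega
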